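/- **Setting.** Let $0<q<1$, $q_n=\sqrt{1-q^{2n}}$ for $n\ge 0$ and $q_n=0$ for $n<0$. Let $\mathcal H$ be the Hilbert space with orthonormal basis $v^{j\uparrow}_{m,l}$ ($2j\in\mathbb N$, $0\le m\le 2j$, $0\le l\le 2j+1$) and $v^{j\downarrow}_{m,l}$ ($2j\in\mathbb N$, $0\le m\le 2j$, $0\le l\le 2j-1$); vectors with other labels are $0$. Let $\mathcal D v^{j\uparrow}_{m,l}=(2j+\tfrac32)v^{j\uparrow}_{m,l}$ and $\mathcal D v^{j\downarrow}_{m,l}=-(2j+\tfrac12)v^{j\downarrow}_{m,l}$. With $v^j_{m,l}$ denoting either component and $j^\pm=j\pm\frac12$, let $$a_+v^j_{m,l}=q_{m+1}q_{l+1}v^{j^+}_{m+1,l+1},\quad a_-v^j_{m,l}=q^{m+l+1}v^{j^-}_{m,l},\quad b_+v^j_{m,l}=q^lq_{m+1}v^{j^+}_{m+1,l},\quad b_-v^j_{m,l}=-q^mq_l\,v^{j^-}_{m,l-1}.$$ Let $J$ be the antilinear isometry with $Jv^{j\uparrow}_{m,l}=i^{2(m+l)-1}v^{j\uparrow}_{2j-m,2j+1-l}$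 and $Jv^{j\downarrow}_{m,l}=i^{8j-2(m+l)-1}v^{j\downarrow}_{2j-m,2j-1-l}$, and $\hat x=JxJ^{-1}$. Let $X$ and $\hat X$ be the $*$-algebras of operators generated by $a_\pm,b_\pm$ and by $\hat a_\pm,\hat b_\pm$, and let $X\hat X$ be the linear span of the products $x\hat y$ with $x\in X$, $\hat y\in\hat X$. For a bounded operator $T$ put $\zeta_{\mathcal D}^T(s)=\mathrm{Tr}(T|\mathcal D|^{-s})$ for $\mathrm{Re}\,s$ large, and let ⨍$\,T$ be the residue at $s=0$ of its meromorphic continuation to $\mathbb C$. **The functionals.** Let $\mathcal F$ be the algebra of noncommutative polynomials in $a,b,a^*,b^*$. Algebra morphisms $\pi'_+,\hat\pi_+$ (resp. $\pi'_-,\hat\pi_-$) from $\mathcal F$ to operators on the span of the vectors $\varepsilon_m\otimes\varepsilon_k$ (resp. $\varepsilon_m\otimes\varepsilon_k\otimes\varepsilon_s$, $s\in\{\uparrow,\downarrow\}$), $m\in\mathbb N$, $k\in\mathbb Z$, are defined by (the factor $\varepsilon_s$, which is unchanged, being suppressed) $$\pi'_\pm(a)\,\varepsilon_m\otimes\varepsilon_k=q_{m+1}\,\varepsilon_{m+1}\otimes\varepsilon_{k+1},\qquad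 \pi'_\pm(b)\,\varepsilon_m\otimes\varepsilon_k=\pm q^m\,\varepsilon_m\otimes\varepsilon_{k+1},$$ $$\hat\pi_+(a)\,\varepsilon_m\otimes\varepsilon_k=q_{k+1-m}\,\varepsilon_m\otimes\varepsilon_{k+1},\qquad \hat\pi_+(b)\,\varepsilon_m\otimes\varepsilon_k=-q^{k-m}\,\varepsilon_{m+1}\otimes\varepsilon_{k+1},$$ $$\hat\pi_-(a)\,\varepsilon_m\otimes\varepsilon_k=q_{k+1+\sigma-m}\,\varepsilon_m\otimes\varepsilon_{k+1},\qquad \hat\pi_-(b)\,\varepsilon_m\otimes\varepsilon_k=q^{k+\sigma-m}\,\varepsilon_{m+1}\otimes\varepsilon_{k+1},$$ with $\sigma=1$ for $s=\uparrow$ and $\sigma=-1$ for $s=\downarrow$; $a^*,b^*$ are mapped to the formal adjoints, and $\varepsilon_{m}=0$ for $m<0$. Let $\tau_1(x)=\frac1{2\pi}\int_0^{2\pi}\mathrm{sy}(x)(e^{i\theta})\,d\theta$ for $x\in\mathcal F$, where $\mathrm{sy}:\mathcal F\to C(S^1)$ is the morphism with $a\mapsto z$, $a^*\mapsto\bar z$,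 $b,b^*\mapsto0$, and put $\tau_1(\pi'_\pm(x)\hat\pi_\pm(y))=\tau_1(x)\tau_1(y)$. For $W=\pi'_+(x)\hat\pi_+(y)$ let $\mathrm{Tr}_N(W)=\sum_{m=0}^N\langle\varepsilon_m\otimes\varepsilon_N,W\,\varepsilon_m\otimes\varepsilon_N\rangle$; for $W=\pi'_-(x)\hat\pi_-(y)$ let $\mathrm{Tr}_N(W)$ be either of the sums $\sum_{m=0}^N\langle\varepsilon_m\otimes\varepsilon_{N-\sigma}\otimes\varepsilon_s,W\,\varepsilon_m\otimes\varepsilon_{N-\sigma}\otimes\varepsilon_s\rangle$, $s=\uparrow,\downarrow$. Put $$\tau_0(W)=\lim_{N\to\infty}\big(\mathrm{Tr}_N(W)-(N+1)\tau_1(W)\big).$$ Let $\tilde\rho$ send a linear combination of products $x\hat y$, with $x$ a noncommutative polynomial in $a_\pm,b_\pm$ and their adjoints and $\hat y$ one in $\hat a_\pm,\hat b_\pm$ and their adjoints, to the formal linear combination of terms $\pi'_+(x_1)\hat\pi_+(y_1)\otimes\pi'_-(x_2)\hat\pi_-(y_2)$ obtained multiplicatively from $$a_+\mapsto a\otimes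 a,\quad a_-\mapsto-q\,b^*\otimes b^*,\quad b_+\mapsto-a\otimes b,\quad b_-\mapsto-b^*\otimes a^*$$ and the adjoint rules, read through $\pi'_+\otimes\pi'_-$ for $a_\pm,b_\pm$ and through $\hat\pi_+\otimes\hat\pi_-$ for $\hat a_\pm,\hat b_\pm$. **Theorem.** The limits defining $\tau_0$ exist (for both choices $s=\uparrow,\downarrow$, with the same value), and $\tau_0$ is linear. Every $T\in X\hat X$ has expressions as linear combinations of products $x\hat y$ as above, and for each of these, with $\tilde\rho(T)$ computed from it: (i) there is an entire function $h$ such that, for $\mathrm{Re}\,s>3$, $T|\mathcal D|^{-s}$ is trace class and $$\zeta_{\mathcal D}^T(s)=2(\tau_1\otimes\tau_1)(\tilde\rho(T))\,\zeta(s-2)+2(\tau_0\otimes\tau_1+\tau_1\otimes\tau_0)(\tilde\rho(T))\,\zeta(s-1)+2\big(\tau_0\otimes\tau_0-\tfrac14\tau_1\otimes\tau_1\big)(\tilde\rho(T))\,\zeta(s)+h(s);$$ (ii) ⨍$\,T|\mathcal D|^{-3}=2(\tau_1\otimes\tau_1)(\tilde\rho(T))$; (iii) ⨍$\,T|\mathcal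 D|^{-2}=2(\tau_0\otimes\tau_1+\tau_1\otimes\tau_0)(\tilde\rho(T))$; (iv) ⨍$\,T|\mathcal D|^{-1}=2(\tau_0\otimes\tau_0-\tfrac14\tau_1\otimes\tau_1)(\tilde\rho(T))$. -/

import Mathlib

open scoped TensorProduct Topology
open Filter

noncomputable section

namespace SUq2

/-! ### The spinorial Hilbert space -/

/-- The two components of a spinor. -/
inductive Spin
  | up
  | down

/-- The sign `+1` for the upper and `-1` for the lower component. -/
def Spin.sgn : Spin → ℤ
  | .up => 1
  | .down => -1

/-- A label `(s, k, m, l)` stands for the vector `v^{j,s}_{m,l}` with `k = 2j`. -/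
abbrev RawSite := Spin × ℤ × ℤ × ℤ

/-- The labels which occur: `0 ≤ m ≤ 2j`, and `0 ≤ l ≤ 2j+1` for the upper component,
`0 ≤ l ≤ 2j-1` for the lower one. -/
def IsSite (x : RawSite) : Prop :=
  0 ≤ x.2.2.1 ∧ x.2.2.1 ≤ x.2.1 ∧ 0 ≤ x.2.2.2 ∧ x.2.2.2 ≤ x.2.1 + x.1.sgn

/-- The index set of the orthonormal basis `v^{j↑}_{m,l}`, `v^{j↓}_{m,l}`. -/
abbrev Site := {x : RawSite // IsSite x}

/-- The Hilbert space `ℋ = ℋ↑ ⊕ ℋ↓`, with orthonormal basis indexed by `Site`. -/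
abbrev Hilb := lp (fun _ : Site => ℂ) 2

/-- Bounded operators on `ℋ`. -/
abbrev BH := Hilb →L[ℂ] Hilb

theorem pull_sum_le (g : Site → Option Site)
    (hg : ∀ x y z, g x = some z → g y = some z → x = y)
    (c : Site → ℂ) (hc : ∀ x, ‖c x‖ ≤ 1) (ψ : Hilb) (s : Finset Site) :
    ∑ y ∈ s, ‖(g y).elim 0 (fun x => c x * ψ x)‖ ^ (2 : ENNReal).toReal
      ≤ ‖ψ‖ ^ (2 : ENNReal).toReal := by
  classical
  have h1 : ∀ y ∈ s, ‖(g y).elim 0 (fun x => c x * ψ x)‖ ^ (2 : ENNReal).toReal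
      ≤ ∑ x ∈ (g y).toFinset, ‖ψ x‖ ^ (2 : ENNReal).toReal := by
    intro y _
    cases h : g y with
    | none => simp
    | some x =>
      simp only [Option.elim_some, Option.toFinset_some, Finset.sum_singleton]
      apply Real.rpow_le_rpow (norm_nonneg _) _ (by simp)
      rw [norm_mul]
      exact mul_le_of_le_one_left (norm_nonneg _) (hc x)
  refine (Finset.sum_le_sum h1).trans ?_
  rw [← Finset.sum_biUnion]
  · exact lp.sum_rpow_le_norm_rpow (by simp) ψ _
  · intro x _ y _ hxy
    rw [Function.onFun, Finset.disjoint_left]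
    intro z hz hz'
    simp only [Option.mem_toFinset, Option.mem_def] at hz hz'
    exact hxy (hg x y z hz hz')

/-- The bounded operator with `(T ψ)(y) = c(x) ψ(x)` if `g y = some x`, and `(T ψ)(y) = 0` if
`g y = none`. In terms of the basis, `T e_x = c(x) e_y` if `g y = some x`, and `T e_x = 0` if `x`
is not attained. -/
def pullOp (g : Site → Option Site) (hg : ∀ x y z, g x = some z → g y = some z → x = y)
    (c : Site → ℂ) (hc : ∀ x, ‖c x‖ ≤ 1) : BH :=
  LinearMap.mkContinuous
    { toFun := fun ψ =>
        (⟨fun y => (g y).elim 0 (fun x => c x * ψ x),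
          memℓp_gen' (pull_sum_le g hg c hc ψ)⟩ : Hilb)
      map_add' := by
        intro ψ φ
        ext y
        simp only [lp.coeFn_add, Pi.add_apply]
        cases g y <;> simp [mul_add]
      map_smul' := by
        intro t ψ
        ext y
        simp only [lp.coeFn_smul, Pi.smul_apply, RingHom.id_apply, smul_eq_mul]
        cases g y <;> simp [mul_left_comm] }
    1
    (fun ψ => by
      rw [one_mul]
      exact lp.norm_le_of_forall_sum_le (by simp) (norm_nonneg _) (pull_sum_le g hg c hc ψ))

/-- The label obtained by changing `2j`, `m`, `l` by the components of `d`. -/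
def RawSite.shift (x : RawSite) (d : ℤ × ℤ × ℤ) : RawSite := (x.1, x.2 + d)

open Classical in
/-- The label `y - d`, if it belongs to a basis vector. -/
def siteSub (d : ℤ × ℤ × ℤ) (y : Site) : Option Site :=
  if h : IsSite (y.1.shift (-d)) then some ⟨_, h⟩ else none

theorem siteSub_inj (d : ℤ × ℤ × ℤ) (x y z : Site) (hx : siteSub d x = some z)
    (hy : siteSub d y = some z) : x = y := by
  unfold siteSub at hx hy
  split_ifs at hx hy
  have h := congrArg Subtype.val ((Option.some.inj hx).trans (Option.some.inj hy).symm)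
  apply Subtype.ext
  simp only [RawSite.shift, Prod.mk.injEq, add_left_inj] at h
  exact Prod.ext h.1 h.2

/-- The operator `v^j_{m,l} ↦ c(m,l) v^{j'}_{m',l'}` with `(2j',m',l') = (2j,m,l) + d`, where
vectors `v` with a label out of range are zero. -/
def shiftOp (d : ℤ × ℤ × ℤ) (c : ℤ → ℤ → ℝ) (hc : ∀ m l, 0 ≤ m → 0 ≤ l → |c m l| ≤ 1) : BH :=
  pullOp (siteSub d) (siteSub_inj d) (fun x => ((c x.1.2.2.1 x.1.2.2.2 : ℝ) : ℂ))
    (fun x => by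
      rw [Complex.norm_real]
      exact hc _ _ x.2.1 x.2.2.2.1)

/-! ### The operators `a_±`, `b_±` -/

/-- `q_n = √(1 - q^{2n})` for `n ≥ 0` and `q_n = 0` for `n < 0`. -/
def qn (q : ℝ) (n : ℤ) : ℝ := if 0 ≤ n then Real.sqrt (1 - q ^ (2 * n)) else 0

theorem abs_qn_le (q : Set.Ioo (0 : ℝ) 1) (n : ℤ) : |qn q n| ≤ 1 := by
  unfold qn
  split_ifs
  · rw [abs_of_nonneg (Real.sqrt_nonneg _)]
    apply Real.sqrt_le_one.mpr
    have : 0 < (q : ℝ) ^ (2 * n) := zpow_pos q.2.1 _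
    linarith
  · simp

theorem abs_zpow_le (q : Set.Ioo (0 : ℝ) 1) (n : ℤ) (hn : 0 ≤ n) : |(q : ℝ) ^ n| ≤ 1 := by
  rw [abs_of_pos (zpow_pos q.2.1 n)]
  exact zpow_le_one₀ q.2.1 q.2.2.le hn

theorem abs_mul_le_one {x y : ℝ} (hx : |x| ≤ 1) (hy : |y| ≤ 1) : |x * y| ≤ 1 := by
  rw [abs_mul]
  exact mul_le_one₀ hx (abs_nonneg _) hy

/-- `a_+ v^j_{m,l} = q_{m+1} q_{l+1} v^{j+1/2}_{m+1,l+1}`. -/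
def aPlus (q : Set.Ioo (0 : ℝ) 1) : BH :=
  shiftOp (1, 1, 1) (fun m l => qn q (m + 1) * qn q (l + 1))
    (fun _ _ _ _ => abs_mul_le_one (abs_qn_le _ _) (abs_qn_le _ _))

/-- `a_- v^j_{m,l} = q^{m+l+1} v^{j-1/2}_{m,l}`. -/
def aMinus (q : Set.Ioo (0 : ℝ) 1) : BH :=
  shiftOp (-1, 0, 0) (fun m l => (q : ℝ) ^ (m + l + 1))
    (fun _ _ hm hl => abs_zpow_le _ _ (by omega))

/-- `b_+ v^j_{m,l} = q^l q_{m+1} v^{j+1/2}_{m+1,l}`. -/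
def bPlus (q : Set.Ioo (0 : ℝ) 1) : BH :=
  shiftOp (1, 1, 0) (fun m l => (q : ℝ) ^ l * qn q (m + 1))
    (fun _ _ _ hl => abs_mul_le_one (abs_zpow_le _ _ hl) (abs_qn_le _ _))

/-- `b_- v^j_{m,l} = -q^m q_l v^{j-1/2}_{m,l-1}`. -/
def bMinus (q : Set.Ioo (0 : ℝ) 1) : BH :=
  shiftOp (-1, 0, -1) (fun m l => -((q : ℝ) ^ m * qn q l))
    (fun _ _ hm _ => by
      rw [abs_neg]
      exact abs_mul_le_one (abs_zpow_le _ _ hm) (abs_qn_le _ _))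

/-! ### The reality operator `J` -/

/-- The label map `v^{j↑}_{m,l} ↦ v^{j↑}_{2j-m,2j+1-l}`, `v^{j↓}_{m,l} ↦ v^{j↓}_{2j-m,2j-1-l}`
(that is, `|j μ n⟩ ↦ |j, -μ, -n⟩`). -/
def siteFlip (x : Site) : Site :=
  ⟨(x.1.1, x.1.2.1, x.1.2.1 - x.1.2.2.1, x.1.2.1 + x.1.1.sgn - x.1.2.2.2), by
    obtain ⟨h1, h2, h3, h4⟩ := x.2
    refine ⟨?_, ?_, ?_, ?_⟩ <;> dsimp only <;> omega⟩

theorem siteFlip_siteFlip (x : Site) : siteFlip (siteFlip x) = x := by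
  apply Subtype.ext
  simp [siteFlip]

/-- The involution `siteFlip` as a permutation. -/
def siteFlipEquiv : Site ≃ Site := ⟨siteFlip, siteFlip, siteFlip_siteFlip, siteFlip_siteFlip⟩

/-- The exponent `2(2j+μ+n) = 2(m+l)-1` for `|j μ n ↑⟩` and `2(2j-μ-n) = 4(2j)-2(m+l)-1` for
`|j μ n ↓⟩`. -/
def phaseExp (x : Site) : ℤ :=
  match x.1.1 with
  | .up => 2 * (x.1.2.2.1 + x.1.2.2.2) - 1
  | .down => 4 * x.1.2.1 - 2 * (x.1.2.2.1 + x.1.2.2.2) - 1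

/-- The phase of `J` on the basis vector with label `x`. -/
def phase (x : Site) : ℂ := Complex.I ^ phaseExp x

theorem norm_phase (x : Site) : ‖phase x‖ = 1 := by
  simp [phase]

theorem phase_mul_conj (x : Site) : phase x * (starRingEnd ℂ) (phase x) = 1 := by
  rw [Complex.mul_conj, Complex.normSq_eq_norm_sq, norm_phase]
  simp

theorem antiunitary_memℓp (c : Site → ℂ) (hc : ∀ x, ‖c x‖ = 1) (ψ : Hilb) :
    Memℓp (fun x => c x * (starRingEnd ℂ) (ψ (siteFlip x))) 2 := by
  have h := (lp.memℓp ψ).summable (by simp)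
  apply memℓp_gen
  simpa [hc, siteFlipEquiv, Function.comp_def] using
    (siteFlipEquiv.summable_iff (f := fun x => ‖ψ x‖ ^ (2 : ENNReal).toReal)).mpr h

/-- The antilinear antiunitary operator `J`, with `J e_x = phase(x) e_{siteFlip x}`. -/
def J : Hilb ≃ₗᵢ⋆[ℂ] Hilb where
  toFun ψ := ⟨fun y => phase (siteFlip y) * (starRingEnd ℂ) (ψ (siteFlip y)),
    antiunitary_memℓp (fun y => phase (siteFlip y)) (fun _ => norm_phase _) ψ⟩
  invFun ψ := ⟨fun x => phase x * (starRingEnd ℂ) (ψ (siteFlip x)),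
    antiunitary_memℓp phase norm_phase ψ⟩
  map_add' ψ φ := by
    ext y
    simp only [lp.coeFn_add, Pi.add_apply, map_add, mul_add]
  map_smul' t ψ := by
    ext y
    simp [mul_left_comm]
  left_inv ψ := by
    ext x
    simp [siteFlip_siteFlip, ← mul_assoc, phase_mul_conj]
  right_inv ψ := by
    ext x
    simp [siteFlip_siteFlip, ← mul_assoc, phase_mul_conj]
  norm_map' ψ := by
    rw [lp.norm_eq_tsum_rpow (by simp), lp.norm_eq_tsum_rpow (by simp)]
    congr 1
    simpa [norm_phase, siteFlipEquiv] using
      siteFlipEquiv.tsum_eq (fun x => ‖ψ x‖ ^ (2 : ENNReal).toReal)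

/-- `T ↦ J T J⁻¹`. -/
def conjJ (T : BH) : BH :=
  (J.toContinuousLinearEquiv : Hilb →SL[starRingEnd ℂ] Hilb).comp
    (T.comp (J.symm.toContinuousLinearEquiv : Hilb →SL[starRingEnd ℂ] Hilb))

/-! ### The algebras `X`, `X̂` and the space `X X̂` -/

/-- Names of the four operators `a_+`, `a_-`, `b_+`, `b_-`. -/
inductive XGen
  | aPlus
  | aMinus
  | bPlus
  | bMinus

/-- The operator with a given name. -/
def xOp (q : Set.Ioo (0 : ℝ) 1) : XGen → BH
  | .aPlus => aPlus q
  | .aMinus => aMinus q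
  | .bPlus => bPlus q
  | .bMinus => bMinus q

/-- The `*`-algebra generated by `a_±`, `b_±`. -/
def X (q : Set.Ioo (0 : ℝ) 1) : StarSubalgebra ℂ BH :=
  StarAlgebra.adjoin ℂ (Set.range (xOp q))

/-- The `*`-algebra generated by `J a_± J⁻¹`, `J b_± J⁻¹`. -/
def XHat (q : Set.Ioo (0 : ℝ) 1) : StarSubalgebra ℂ BH :=
  StarAlgebra.adjoin ℂ (Set.range fun g => conjJ (xOp q g))

/-- `X X̂`, the linear span of the products `x ŷ` with `x ∈ X`, `ŷ ∈ X̂`. -/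
def XXHat (q : Set.Ioo (0 : ℝ) 1) : Submodule ℂ BH :=
  Subalgebra.toSubmodule (X q).toSubalgebra * Subalgebra.toSubmodule (XHat q).toSubalgebra

/-! ### Noncommutative polynomials -/

/-- Noncommutative polynomials in the letters `g` and `g*`, for `g : G`. -/
abbrev FreeStar (G : Type) := FreeAlgebra ℂ (G ⊕ G)

/-- The letter `g`. -/
def FreeStar.gen {G : Type} (g : G) : FreeStar G := FreeAlgebra.ι ℂ (Sum.inl g)

/-- The letter `g*`. -/
def FreeStar.genStar {G : Type} (g : G) : FreeStar G := FreeAlgebra.ι ℂ (Sum.inr g)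

/-- The homomorphism with `g ↦ f g` and `g* ↦ f' g`. -/
def FreeStar.lift {G A : Type} [Semiring A] [Algebra ℂ A] (f f' : G → A) : FreeStar G →ₐ[ℂ] A :=
  FreeAlgebra.lift ℂ (Sum.elim f f')

/-- Substitution of bounded operators and their adjoints. -/
def evalStar (f : XGen → BH) : FreeStar XGen →ₐ[ℂ] BH :=
  FreeStar.lift f (fun g => star (f g))

/-- The operator `∑ xᵢ ŷᵢ ∈ X X̂` written by a formal expression `∑ xᵢ ⊗ yᵢ`: in `xᵢ` one
substitutes `a_±`, `b_±`, and in `yᵢ` one substitutes `J a_± J⁻¹`, `J b_± J⁻¹`. -/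
def realize (q : Set.Ioo (0 : ℝ) 1) : FreeStar XGen ⊗[ℂ] FreeStar XGen →ₗ[ℂ] BH :=
  LinearMap.mul' ℂ BH ∘ₗ
    TensorProduct.map (evalStar (xOp q)).toLinearMap
      (evalStar fun g => conjJ (xOp q g)).toLinearMap

theorem range_evalStar (f : XGen → BH) :
    (evalStar f).range = (StarAlgebra.adjoin ℂ (Set.range f)).toSubalgebra := by
  rw [evalStar, FreeStar.lift, ← Algebra.adjoin_range_eq_range_freeAlgebra_lift,
    StarAlgebra.adjoin_toSubalgebra, Set.Sum.elim_range]
  congr 2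
  ext T
  simp only [Set.mem_range, Set.mem_star]
  exact exists_congr fun g => ⟨fun h => by rw [← h, star_star], fun h => by rw [h, star_star]⟩

/-- `X X̂` consists exactly of the operators which have a formal expression. -/
theorem range_realize (q : Set.Ioo (0 : ℝ) 1) : LinearMap.range (realize q) = XXHat q := by
  rw [XXHat, X, XHat, ← range_evalStar, ← range_evalStar, realize, LinearMap.range_comp,
    TensorProduct.range_map, Submodule.map_map₂, Submodule.mul_eq_map₂]
  congr 1

/-! ### The morphism `ρ̃` -/

/-- The generators `a`, `b` of `𝒜(SU_q(2))`. -/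
inductive AGen
  | a
  | b

open FreeStar in
/-- The correspondence `a_+ ↦ a ⊗ a`, `a_- ↦ -q b* ⊗ b*`, `b_+ ↦ -a ⊗ b`, `b_- ↦ -b* ⊗ a*`. -/
def rhoGen (q : ℝ) : XGen → FreeStar AGen ⊗[ℂ] FreeStar AGen
  | .aPlus => gen .a ⊗ₜ gen .a
  | .aMinus => (-(q : ℂ)) • (genStar .b ⊗ₜ genStar .b)
  | .bPlus => -(gen .a ⊗ₜ gen .b)
  | .bMinus => -(genStar .b ⊗ₜ genStar .a)

open FreeStar in
/-- The adjoint correspondence `a_+* ↦ a* ⊗ a*`, and so on. -/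
def rhoGenStar (q : ℝ) : XGen → FreeStar AGen ⊗[ℂ] FreeStar AGen
  | .aPlus => genStar .a ⊗ₜ genStar .a
  | .aMinus => (-(q : ℂ)) • (gen .b ⊗ₜ gen .b)
  | .bPlus => -(genStar .a ⊗ₜ genStar .b)
  | .bMinus => -(gen .b ⊗ₜ gen .a)

/-- The extension of the correspondence to noncommutative polynomials. -/
def rho (q : ℝ) : FreeStar XGen →ₐ[ℂ] FreeStar AGen ⊗[ℂ] FreeStar AGen :=
  FreeStar.lift (rhoGen q) (rhoGenStar q)

/-- An element `x ⊗ y` stands for the operator `π'_+(x) π̂_+(y)`, or for `π'_-(x) π̂_-(y)`. -/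
abbrev PairAlg := FreeStar AGen ⊗[ℂ] FreeStar AGen

/-- `ρ̃` on formal expressions: if `x ↦ ∑ x₁ ⊗ x₂` and `y ↦ ∑ y₁ ⊗ y₂` under `rho`, then
`x ŷ ↦ ∑ π'_+(x₁) π̂_+(y₁) ⊗ π'_-(x₂) π̂_-(y₂)`. -/
def rhoTilde (q : ℝ) : FreeStar XGen ⊗[ℂ] FreeStar XGen →ₗ[ℂ] PairAlg ⊗[ℂ] PairAlg :=
  (TensorProduct.tensorTensorTensorComm ℂ (FreeStar AGen) (FreeStar AGen) (FreeStar AGen)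
      (FreeStar AGen)).toLinearMap ∘ₗ
    TensorProduct.map (rho q).toLinearMap (rho q).toLinearMap

/-! ### The operators `π'_±` and `π̂_±`

They are given on finitely supported vectors, `π̂_±` being unbounded on the part where `2j` is
very negative. -/

/-- The linear span of the `ε_m ⊗ ε_{2j}` in `ℓ²(ℕ) ⊗ ℓ²(ℤ)`. -/
abbrev VPlus := (ℕ × ℤ) →₀ ℂ

/-- The linear span of the `ε_l ⊗ ε_{2j} ⊗ ε_s`, `s = ↑, ↓`, in `ℓ²(ℕ) ⊗ ℓ²(ℤ) ⊗ ℂ²`. -/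
abbrev VMinus := (ℕ × ℤ × Spin) →₀ ℂ

/-- `ε_m ⊗ ε_k`, with `ε_m = 0` for `m < 0`. -/
def epsPlus (m k : ℤ) : VPlus := if 0 ≤ m then Finsupp.single (m.toNat, k) 1 else 0

/-- `ε_l ⊗ ε_k ⊗ ε_s`, with `ε_l = 0` for `l < 0`. -/
def epsMinus (l k : ℤ) (s : Spin) : VMinus :=
  if 0 ≤ l then Finsupp.single (l.toNat, k, s) 1 else 0

/-- The linear map with `ε_m ⊗ ε_k ↦ f m k`. -/
def opPlus (f : ℤ → ℤ → VPlus) : Module.End ℂ VPlus :=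
  Finsupp.linearCombination ℂ fun p => f p.1 p.2

/-- The linear map with `ε_l ⊗ ε_k ⊗ ε_s ↦ f l k s`. -/
def opMinus (f : ℤ → ℤ → Spin → VMinus) : Module.End ℂ VMinus :=
  Finsupp.linearCombination ℂ fun p => f p.1 p.2.1 p.2.2

/-- `π'_+ = π_+ ⊗ V`, where `π_+(a) ε_m = q_{m+1} ε_{m+1}` and `π_+(b) ε_m = q^m ε_m`. -/
def piPlus (q : ℝ) : FreeStar AGen →ₐ[ℂ] Module.End ℂ VPlus :=
  FreeStar.lift
    (fun
      | .a => opPlus fun m k => (qn q (m + 1) : ℂ) • epsPlus (m + 1) (k + 1)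
      | .b => opPlus fun m k => ((q ^ m : ℝ) : ℂ) • epsPlus m (k + 1))
    (fun
      | .a => opPlus fun m k => (qn q m : ℂ) • epsPlus (m - 1) (k - 1)
      | .b => opPlus fun m k => ((q ^ m : ℝ) : ℂ) • epsPlus m (k - 1))

/-- `π̂_+(a) ε_m ⊗ ε_k = q_{k+1-m} ε_m ⊗ ε_{k+1}`, `π̂_+(b) ε_m ⊗ ε_k = -q^{k-m} ε_{m+1} ⊗ ε_{k+1}`,
and their adjoints. -/
def piHatPlus (q : ℝ) : FreeStar AGen →ₐ[ℂ] Module.End ℂ VPlus :=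
  FreeStar.lift
    (fun
      | .a => opPlus fun m k => (qn q (k + 1 - m) : ℂ) • epsPlus m (k + 1)
      | .b => opPlus fun m k => ((-q ^ (k - m) : ℝ) : ℂ) • epsPlus (m + 1) (k + 1))
    (fun
      | .a => opPlus fun m k => (qn q (k - m) : ℂ) • epsPlus m (k - 1)
      | .b => opPlus fun m k => ((-q ^ (k - m) : ℝ) : ℂ) • epsPlus (m - 1) (k - 1))

/-- `π'_- = π_- ⊗ V ⊗ 1`, where `π_-(a) ε_l = q_{l+1} ε_{l+1}` and `π_-(b) ε_l = -q^l ε_l`. -/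
def piMinus (q : ℝ) : FreeStar AGen →ₐ[ℂ] Module.End ℂ VMinus :=
  FreeStar.lift
    (fun
      | .a => opMinus fun l k s => (qn q (l + 1) : ℂ) • epsMinus (l + 1) (k + 1) s
      | .b => opMinus fun l k s => ((-q ^ l : ℝ) : ℂ) • epsMinus l (k + 1) s)
    (fun
      | .a => opMinus fun l k s => (qn q l : ℂ) • epsMinus (l - 1) (k - 1) s
      | .b => opMinus fun l k s => ((-q ^ l : ℝ) : ℂ) • epsMinus l (k - 1) s)

/-- `π̂_-(a) ε_l ⊗ ε_k ⊗ ε_s = q_{k+1±1-l} ε_l ⊗ ε_{k+1} ⊗ ε_s`,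
`π̂_-(b) ε_l ⊗ ε_k ⊗ ε_s = q^{k±1-l} ε_{l+1} ⊗ ε_{k+1} ⊗ ε_s`, and their adjoints, with the sign
`+` for `s = ↑` and `-` for `s = ↓`. -/
def piHatMinus (q : ℝ) : FreeStar AGen →ₐ[ℂ] Module.End ℂ VMinus :=
  FreeStar.lift
    (fun
      | .a => opMinus fun l k s => (qn q (k + 1 + s.sgn - l) : ℂ) • epsMinus l (k + 1) s
      | .b => opMinus fun l k s =>
          ((q ^ (k + s.sgn - l) : ℝ) : ℂ) • epsMinus (l + 1) (k + 1) s)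
    (fun
      | .a => opMinus fun l k s => (qn q (k + s.sgn - l) : ℂ) • epsMinus l (k - 1) s
      | .b => opMinus fun l k s =>
          ((q ^ (k + s.sgn - l) : ℝ) : ℂ) • epsMinus (l - 1) (k - 1) s)

/-- `x ⊗ y ↦ π'_+(x) π̂_+(y)`. -/
def pairPlus (q : ℝ) : PairAlg →ₗ[ℂ] Module.End ℂ VPlus :=
  LinearMap.mul' ℂ _ ∘ₗ TensorProduct.map (piPlus q).toLinearMap (piHatPlus q).toLinearMap

/-- `x ⊗ y ↦ π'_-(x) π̂_-(y)`. -/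
def pairMinus (q : ℝ) : PairAlg →ₗ[ℂ] Module.End ℂ VMinus :=
  LinearMap.mul' ℂ _ ∘ₗ TensorProduct.map (piMinus q).toLinearMap (piHatMinus q).toLinearMap

/-! ### The functionals `τ_0` and `τ_1` -/

/-- `Tr_N(W) = ∑_{m=0}^N ⟨ε_m ⊗ ε_N, W ε_m ⊗ ε_N⟩`. -/
def trPlus (N : ℕ) (W : Module.End ℂ VPlus) : ℂ :=
  ∑ m ∈ Finset.range (N + 1), W (Finsupp.single (m, (N : ℤ)) 1) (m, (N : ℤ))

/-- `Tr_N^s(W) = ∑_{l=0}^N ⟨ε_l ⊗ ε_{N∓1} ⊗ ε_s, W ε_l ⊗ ε_{N∓1} ⊗ ε_s⟩`, with the sign `-` for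
`s = ↑` and `+` for `s = ↓`. -/
def trMinus (s : Spin) (N : ℕ) (W : Module.End ℂ VMinus) : ℂ :=
  ∑ l ∈ Finset.range (N + 1),
    W (Finsupp.single (l, (N : ℤ) - s.sgn, s) 1) (l, (N : ℤ) - s.sgn, s)

/-- The symbol map: `a ↦ z`, `a* ↦ z̄`, `b, b* ↦ 0`. -/
def symbol : FreeStar AGen →ₐ[ℂ] C(Circle, ℂ) :=
  FreeStar.lift
    (fun
      | .a => ⟨fun z => (z : ℂ), by fun_prop⟩
      | .b => 0)
    (fun
      | .a => star ⟨fun z => (z : ℂ), by fun_prop⟩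
      | .b => 0)

/-- `τ_1(x) = (1/2π) ∫_0^{2π} σ(x)(e^{iθ}) dθ`. -/
def tau1Base : FreeStar AGen →ₗ[ℂ] ℂ where
  toFun x := (2 * Real.pi : ℂ)⁻¹ * ∫ θ in (0 : ℝ)..(2 * Real.pi), symbol x (Circle.exp θ)
  map_add' x y := by
    simp only [map_add, ContinuousMap.add_apply]
    rw [intervalIntegral.integral_add, mul_add]
    · exact ((symbol x).continuous.comp Circle.exp.continuous).intervalIntegrable _ _
    · exact ((symbol y).continuous.comp Circle.exp.continuous).intervalIntegrable _ _
  map_smul' t x := by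
    simp only [map_smul, ContinuousMap.smul_apply, smul_eq_mul, RingHom.id_apply]
    rw [intervalIntegral.integral_const_mul, mul_left_comm]

/-- `τ_1(π'_±(x) π̂_±(y)) = τ_1(π_±(x)) τ_1(π_±(y))`. -/
def tau1 : PairAlg →ₗ[ℂ] ℂ :=
  LinearMap.mul' ℂ ℂ ∘ₗ TensorProduct.map tau1Base tau1Base

/-- `τ` is the functional `τ_0` on the combinations of the `π'_+(x) π̂_+(y)`:
`τ(w) = lim_N (Tr_N(w) - (N+1) τ_1(w))`, where the limits exist. -/
def IsTau0Plus (q : ℝ) (τ : PairAlg →ₗ[ℂ] ℂ) : Prop :=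
  ∀ w, Tendsto (fun N : ℕ => trPlus N (pairPlus q w) - ((N : ℂ) + 1) * tau1 w) atTop (𝓝 (τ w))

/-- `τ` is the functional `τ_0` on the combinations of the `π'_-(x) π̂_-(y)`:
`τ(w) = lim_N (Tr_N(w) - (N+1) τ_1(w))`, where the limits exist, both for `Tr_N = Tr_N^↑` and for
`Tr_N = Tr_N^↓`. -/
def IsTau0Minus (q : ℝ) (τ : PairAlg →ₗ[ℂ] ℂ) : Prop :=
  ∀ s w, Tendsto (fun N : ℕ => trMinus s N (pairMinus q w) - ((N : ℂ) + 1) * tau1 w) atTop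
    (𝓝 (τ w))

/-- The functional `σ ⊗ τ`. -/
def tensorFun (σ τ : PairAlg →ₗ[ℂ] ℂ) : PairAlg ⊗[ℂ] PairAlg →ₗ[ℂ] ℂ :=
  LinearMap.mul' ℂ ℂ ∘ₗ TensorProduct.map σ τ

/-! ### The Dirac operator, traces and the noncommutative integral -/

/-- The eigenvalue of the Dirac operator on the basis vector with label `x`: `2j + 3/2` on the upper
and `-2j - 1/2` on the lower component. -/
def diracEigenvalue (x : Site) : ℝ :=
  match x.1.1 with
  | .up => x.1.2.1 + 3 / 2
  | .down => -(x.1.2.1 : ℝ) - 1 / 2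

theorem one_le_abs_diracEigenvalue (x : Site) : 1 ≤ |diracEigenvalue x| := by
  obtain ⟨⟨s, k, m, l⟩, h1, h2, h3, h4⟩ := x
  dsimp only at h1 h2 h3 h4
  cases s with
  | up =>
    have hk : (0 : ℝ) ≤ k := by exact_mod_cast h1.trans h2
    simp only [diracEigenvalue]
    rw [abs_of_nonneg (by linarith)]
    linarith
  | down =>
    have hk' : (1 : ℤ) ≤ k := by
      simp only [Spin.sgn] at h4
      omega
    have hk : (1 : ℝ) ≤ k := by exact_mod_cast hk'
    simp only [diracEigenvalue]
    rw [abs_of_nonpos (by linarith)]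
    linarith

theorem norm_absDirac_cpow_le (s : ℂ) (hs : 0 ≤ s.re) (x : Site) :
    ‖((|diracEigenvalue x| : ℝ) : ℂ) ^ (-s)‖ ≤ 1 := by
  have h := one_le_abs_diracEigenvalue x
  rw [Complex.norm_cpow_eq_rpow_re_of_pos (by linarith), Complex.neg_re]
  exact Real.rpow_le_one_of_one_le_of_nonpos h (by linarith)

/-- The bounded operator `|D|^{-s}`, for `Re s ≥ 0`. -/
def absDiracPow (s : ℂ) (hs : 0 ≤ s.re) : BH :=
  pullOp some (fun _ _ _ hx hy => Option.some.inj (hx.trans hy.symm))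
    (fun x => ((|diracEigenvalue x| : ℝ) : ℂ) ^ (-s)) (norm_absDirac_cpow_le s hs)

/-- `T` is trace class with `Tr T = t`: in every orthonormal basis the diagonal matrix entries are
(absolutely) summable, with sum `t`. -/
def HasTrace (T : BH) (t : ℂ) : Prop :=
  ∀ (κ : Type) (e : HilbertBasis κ ℂ Hilb), HasSum (fun i => inner ℂ (e i) (T (e i))) t

/-- The residue of `F` at `z` is `c`, for a function `F` holomorphic in a punctured neighbourhood
of `z`. -/
def HasResidueAt (F : ℂ → ℂ) (z c : ℂ) : Prop :=
  ∀ᶠ r in 𝓝[>] (0 : ℝ), (2 * Real.pi * Complex.I : ℂ)⁻¹ * (∮ w in C(z, r), F w) = c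

/-- `⨍ T = c`, that is, the function `ζ_D^T(s) = Tr(T |D|^{-s})`, defined for `Re s` large, has a
meromorphic extension to the plane, and its residue at `s = 0` is `c`. -/
def HasNCIntegral (T : BH) (c : ℂ) : Prop :=
  ∃ F : ℂ → ℂ, Meromorphic F ∧
    (∃ r : ℝ, ∀ (s : ℂ) (hs : 0 ≤ s.re), r < s.re → HasTrace (T * absDiracPow s hs) (F s)) ∧
    HasResidueAt F 0 c

end SUq2

end

noncomputable section

namespace SUq2

open Asymptotics

/-! The generators, their adjoints and their reflections send basis vectors to multiples of basis
vectors, hence so do words in them. Use the coordinates `m`, `n = 2j - m` and `l`, `n' = 2j ± 1 -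
l`; a label is admissible exactly when all four are nonnegative. The weight of a word is then a
product `f(m) h(n) · f'(l) h'(n')`, and the admissibility tests along the word factor in the same
way. So a word acts as a scalar times two truncated weighted shifts side by side, and these are the
two legs of `ρ̃` (`ActsSite`, `ActsSite.mul`).

Every factor converges with error `O(q^n)`. The trace of a leg over the vectors with `m + n = N` is
zero if the leg moves the labels. Otherwise it is the convolution `∑ f(m) h(N-m) = (N+1) a b + t` up
to a rapidly decreasing term (`exists_conv_rapidDecay`). The model operators `π'_± π̂_±` differ from
the legs only in having no truncation at `n = 0`. This does not change `t`: either `f` decays, or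
the weights vanish by themselves where the truncation would act (`Symb.link`,
`Symb.exists_trace_asymptotics`). Hence `a b` gives `τ_1` and `t` is `τ_0`.

The eigenspace `|D| = x = p + 3/2` consists of an upper block with `m + n = p`, `l + n' = p + 1` and
a lower block with these two sums exchanged. Adding the two products of leg traces gives `2 τ_1τ_1
x² + 2 (τ_0τ_1 + τ_1τ_0) x + 2 (τ_0τ_0 - τ_1τ_1/4)` up to rapid decay (`levelTrace_asymptotics`).
Summing against `x^{-s}` turns the powers of `x` into shifted Riemann zeta functions and the
remainder into an entire function (`exists_hasTrace_zeta`). The integrals are read off from the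
simple pole of `ζ` at 1 (`hasNCIntegral_of_zeta`). -/

/-! ### Sequences converging exponentially fast -/

/-- `f n = a + O(q^n)` as `n → ∞`. -/
def ExpConv (q : ℝ) (f : ℤ → ℂ) (a : ℂ) : Prop :=
  (fun n : ℤ => f n - a) =O[atTop] fun n : ℤ => q ^ n

theorem ExpConv.const (q : ℝ) (a : ℂ) : ExpConv q (fun _ => a) a := by
  simpa [ExpConv] using isBigO_zero _ _

theorem ExpConv.congr {q : ℝ} {f g : ℤ → ℂ} {a : ℂ} (hf : ExpConv q f a) (N : ℤ)
    (h : ∀ n, N ≤ n → f n = g n) : ExpConv q g a :=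
  IsBigO.congr' hf ((eventually_ge_atTop N).mono fun n hn => by simp only [h n hn]) EventuallyEq.rfl

theorem zpow_isBigO_one (q : Set.Ioo (0 : ℝ) 1) :
    (fun n : ℤ => (q : ℝ) ^ n) =O[atTop] fun _ => (1 : ℝ) := by
  refine IsBigO.of_bound 1 ((eventually_ge_atTop 0).mono fun n hn => ?_)
  rw [Real.norm_eq_abs, norm_one, mul_one]
  exact abs_zpow_le q n hn

theorem ExpConv.mul {q : Set.Ioo (0 : ℝ) 1} {f g : ℤ → ℂ} {a b : ℂ} (hf : ExpConv q f a)
    (hg : ExpConv q g b) : ExpConv q (fun n => f n * g n) (a * b) := by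
  have hg1 : g =O[atTop] fun _ => (1 : ℝ) := by
    have := (IsBigO.trans hg (zpow_isBigO_one q)).add
      (isBigO_const_const b (one_ne_zero (α := ℝ)) atTop)
    simpa using this
  have h1 : (fun n => (f n - a) * g n) =O[atTop] fun n : ℤ => (q : ℝ) ^ n := by
    simpa using IsBigO.mul hf hg1
  exact (h1.add (IsBigO.const_mul_left hg a)).congr_left fun n => by ring

theorem ExpConv.shift {q : Set.Ioo (0 : ℝ) 1} {f : ℤ → ℂ} {a : ℂ} (hf : ExpConv q f a) (d : ℤ) :
    ExpConv q (fun n => f (n + d)) a := by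
  have h := IsBigO.comp_tendsto hf (tendsto_atTop_add_const_right atTop d tendsto_id)
  refine h.trans ?_
  simp only [Function.comp_def, id, zpow_add₀ q.2.1.ne']
  exact (isBigO_refl _ _).mul (isBigO_const_const _ one_ne_zero _) |>.congr_right (by simp)

theorem expConv_zpow (q : Set.Ioo (0 : ℝ) 1) : ExpConv q (fun n => ((q ^ n : ℝ) : ℂ)) 0 :=
  IsBigO.of_bound 1 (Eventually.of_forall fun n => by simp)

theorem expConv_qn (q : Set.Ioo (0 : ℝ) 1) : ExpConv q (fun n => (qn q n : ℂ)) 1 := by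
  refine IsBigO.of_bound 1 ((eventually_ge_atTop 0).mono fun n hn => ?_)
  have h0 : 0 < (q : ℝ) ^ n := zpow_pos q.2.1 n
  have h1 : (q : ℝ) ^ n ≤ 1 := zpow_le_one₀ q.2.1 q.2.2.le hn
  have h2 : (q : ℝ) ^ (2 * n) = (q : ℝ) ^ n * (q : ℝ) ^ n := by
    rw [two_mul, zpow_add₀ q.2.1.ne']
  rw [← Complex.ofReal_one, ← Complex.ofReal_sub, Complex.norm_real, Real.norm_eq_abs, one_mul,
    Real.norm_of_nonneg h0.le, qn, if_pos hn, h2]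
  have h3 : Real.sqrt (1 - (q : ℝ) ^ n * (q : ℝ) ^ n) ≤ 1 :=
    Real.sqrt_le_one.mpr (by nlinarith)
  -- With `t = q^n ≤ 1` one has `(1 - t)² ≤ 1 - t²`.
  have h4 : 1 - (q : ℝ) ^ n ≤ Real.sqrt (1 - (q : ℝ) ^ n * (q : ℝ) ^ n) :=
    Real.le_sqrt_of_sq_le (by nlinarith)
  rw [abs_le]
  constructor <;> linarith

/-- An asymptotic bound becomes a bound at every natural number because `q^n` never vanishes. -/
theorem ExpConv.exists_bound {q : Set.Ioo (0 : ℝ) 1} {f : ℤ → ℂ} {a : ℂ} (hf : ExpConv q f a) :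
    ∃ C : ℝ, 0 < C ∧ ∀ n : ℕ, ‖f n - a‖ ≤ C * (q : ℝ) ^ n := by
  have h := IsBigO.comp_tendsto hf tendsto_natCast_atTop_atTop
  obtain ⟨C, hC, h⟩ := bound_of_isBigO_nat_atTop h
  refine ⟨C, hC, fun n => ?_⟩
  have := h (x := n) (by simpa using (pow_pos q.2.1 n).ne')
  simpa [abs_of_pos q.2.1] using this

/-! ### Rapidly decreasing sequences -/

/-- `E` decreases faster than any power of `n`. -/
abbrev RapidDecay (E : ℕ → ℂ) : Prop := SuperpolynomialDecay atTop (fun n : ℕ => (n : ℂ)) E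

theorem RapidDecay.zero : RapidDecay fun _ => 0 := SuperpolynomialDecay.congr
  (superpolynomialDecay_zero _ _) fun _ => rfl

theorem RapidDecay.of_norm_le {E G : ℕ → ℂ} (hG : RapidDecay G) (h : ∀ n, ‖E n‖ ≤ ‖G n‖) :
    RapidDecay E := fun p => by
  refine squeeze_zero_norm (fun n => ?_) (tendsto_zero_iff_norm_tendsto_zero.mp (hG p))
  rw [norm_mul, norm_mul]
  exact mul_le_mul_of_nonneg_left (h n) (norm_nonneg _)

theorem rapidDecay_pow (q : Set.Ioo (0 : ℝ) 1) :
    RapidDecay fun n => ((q : ℝ) : ℂ) ^ n := fun p => by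
  have h := tendsto_pow_const_mul_const_pow_of_abs_lt_one p (r := (q : ℝ))
    (by rw [abs_of_pos q.2.1]; exact q.2.2)
  have h1 := (Complex.continuous_ofReal.tendsto 0).comp h
  rw [Complex.ofReal_zero] at h1
  refine h1.congr fun n => ?_
  simp

/-- The factor `n + 1` allows for the number of terms of a convolution sum. -/
theorem RapidDecay.of_le_mul_pow {q : Set.Ioo (0 : ℝ) 1} {E : ℕ → ℂ} {C : ℝ}
    (h : ∀ n : ℕ, ‖E n‖ ≤ C * ((n : ℝ) + 1) * (q : ℝ) ^ n) : RapidDecay E := by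
  have h1 : RapidDecay fun n : ℕ => (C : ℂ) * ((n : ℂ) * ((q : ℝ) : ℂ) ^ n + ((q : ℝ) : ℂ) ^ n) :=
    ((rapidDecay_pow q).param_mul.add (rapidDecay_pow q)).const_mul _
  refine h1.of_norm_le fun n => (h n).trans ((le_abs_self _).trans (le_of_eq ?_))
  rw [← Real.norm_eq_abs, ← Complex.norm_real]
  push_cast
  congr 1
  ring

theorem RapidDecay.comp_succ {E : ℕ → ℂ} (hE : RapidDecay E) : RapidDecay fun n => E (n + 1) :=
  fun p => by
  refine squeeze_zero_norm (fun n => ?_)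
    ((tendsto_zero_iff_norm_tendsto_zero.mp (hE p)).comp (tendsto_add_atTop_nat 1))
  simp only [Function.comp_apply, norm_mul, norm_pow, Complex.norm_natCast]
  gcongr
  linarith

theorem RapidDecay.tendsto_zero {E : ℕ → ℂ} (hE : RapidDecay E) : Tendsto E atTop (𝓝 0) := by
  simpa using hE 0

/-! ### Convolution sums -/

/-- The sum `∑_{m=0}^N f(m) g(N-m)`. -/
def conv (f g : ℤ → ℂ) (N : ℕ) : ℂ := ∑ m ∈ Finset.range (N + 1), f m * g ((N : ℤ) - m)

/-- Each of the `N + 1` terms is bounded by a multiple of `q^m q^(N-m) = q^N`. -/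
theorem conv_rapidDecay {q : Set.Ioo (0 : ℝ) 1} {f g : ℤ → ℂ} (hf : ExpConv q f 0)
    (hg : ExpConv q g 0) : RapidDecay (conv f g) := by
  obtain ⟨C, hC, hf⟩ := hf.exists_bound
  obtain ⟨K, hK, hg⟩ := hg.exists_bound
  refine RapidDecay.of_le_mul_pow (q := q) (C := C * K) fun N => ?_
  have h : ∀ m ∈ Finset.range (N + 1), ‖f m * g ((N : ℤ) - m)‖ ≤ C * K * (q : ℝ) ^ N := by
    intro m hm
    obtain ⟨n, rfl⟩ := Nat.exists_eq_add_of_le (Nat.lt_succ_iff.mp (Finset.mem_range.mp hm))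
    have hn : ((m + n : ℕ) : ℤ) - m = n := by push_cast; ring
    rw [hn, norm_mul, pow_add]
    have h1 := hf m
    have h2 := hg n
    rw [sub_zero] at h1 h2
    calc ‖f m‖ * ‖g n‖ ≤ (C * (q : ℝ) ^ m) * (K * (q : ℝ) ^ n) :=
          mul_le_mul h1 h2 (norm_nonneg _) ((norm_nonneg _).trans h1)
      _ = _ := by ring
  refine (norm_sum_le_of_le _ h).trans (le_of_eq ?_)
  rw [Finset.sum_const, Finset.card_range, nsmul_eq_mul]
  push_cast
  ring

/-- The constant is the sum of the whole series, and the error is a tail dominated by a geometric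
series. -/
theorem exists_sum_range_rapidDecay {q : Set.Ioo (0 : ℝ) 1} {f : ℤ → ℂ} {a : ℂ}
    (hf : ExpConv q f a) :
    ∃ t, RapidDecay fun N => ∑ m ∈ Finset.range (N + 1), (f m - a) - t := by
  obtain ⟨C, hC, hf⟩ := hf.exists_bound
  have hg : Summable fun n : ℕ => C * (q : ℝ) ^ n :=
    (summable_geometric_of_lt_one q.2.1.le q.2.2).mul_left C
  have hs : Summable fun n : ℕ => f n - a := hg.of_norm_bounded hf
  refine ⟨∑' n : ℕ, (f n - a), ?_⟩
  have h1 : RapidDecay fun N : ℕ => ((C / (1 - q) : ℝ) : ℂ) * ((q : ℝ) : ℂ) ^ (N + 1) :=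
    (rapidDecay_pow q).comp_succ.const_mul _
  refine h1.of_norm_le fun N => ?_
  rw [← hs.sum_add_tsum_nat_add (N + 1), sub_add_cancel_left, norm_neg]
  have hq : 0 < 1 - (q : ℝ) := sub_pos.mpr q.2.2
  have h2 : HasSum (fun n : ℕ => C * (q : ℝ) ^ (n + (N + 1)))
      (C / (1 - q) * (q : ℝ) ^ (N + 1)) := by
    have := (hasSum_geometric_of_lt_one q.2.1.le q.2.2).mul_left (C * (q : ℝ) ^ (N + 1))
    convert! this using 1
    · ext n; ring
    · ring
  refine (tsum_of_norm_bounded h2 fun n => hf _).trans (le_of_eq ?_)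
  rw [norm_mul, norm_pow, Complex.norm_real, Complex.norm_real, Real.norm_of_nonneg (by positivity),
    Real.norm_of_nonneg q.2.1.le]

theorem sum_range_reflect_int (g : ℤ → ℂ) (N : ℕ) :
    ∑ m ∈ Finset.range (N + 1), g ((N : ℤ) - m) = ∑ m ∈ Finset.range (N + 1), g m := by
  rw [← Finset.sum_range_reflect]
  refine Finset.sum_congr rfl fun m hm => ?_
  have := Finset.mem_range.mp hm
  congr 1
  omega

/-- Expand `f g = ab + (f-a) b + a (g-b) + (f-a)(g-b)`. The two middle terms contribute convergent
series to the constant, and the last one decays by `conv_rapidDecay`. -/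
theorem exists_conv_rapidDecay {q : Set.Ioo (0 : ℝ) 1} {f g : ℤ → ℂ} {a b : ℂ}
    (hf : ExpConv q f a) (hg : ExpConv q g b) :
    ∃ t, RapidDecay fun N => conv f g N - (((N : ℂ) + 1) * (a * b) + t) := by
  obtain ⟨t, ht⟩ := exists_sum_range_rapidDecay hf
  obtain ⟨u, hu⟩ := exists_sum_range_rapidDecay hg
  have hf0 : ExpConv q (fun n => f n - a) 0 := by simpa [ExpConv] using hf
  have hg0 : ExpConv q (fun n => g n - b) 0 := by simpa [ExpConv] using hg
  refine ⟨t * b + a * u, (((ht.mul_const b).add (hu.const_mul a)).add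
    (conv_rapidDecay hf0 hg0)).congr fun N => ?_⟩
  have h1 : conv f g N = ∑ m ∈ Finset.range (N + 1), ((f m - a) * b + a * (g ((N : ℤ) - m) - b) +
      (f m - a) * (g ((N : ℤ) - m) - b) + a * b) := Finset.sum_congr rfl fun m _ => by ring
  simp only [Finset.sum_add_distrib, ← Finset.sum_mul, ← Finset.mul_sum,
    sum_range_reflect_int (fun n => g n - b), Finset.sum_const, Finset.card_range,
    nsmul_eq_mul] at h1
  rw [h1, Pi.add_apply, Pi.add_apply, conv]
  push_cast
  ring

/-- If `f` decays, the convolution sees only the limit of the other factor up to rapid decay. This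
makes truncation harmless when `a = 0`. -/
theorem conv_sub_conv_rapidDecay {q : Set.Ioo (0 : ℝ) 1} {f g h : ℤ → ℂ} {b : ℂ}
    (hf : ExpConv q f 0) (hg : ExpConv q g b) (hh : ExpConv q h b) :
    RapidDecay fun N => conv f g N - conv f h N := by
  have hgh : ExpConv q (fun n => g n - h n) 0 := by
    refine (IsBigO.sub hg hh).congr_left fun n => by ring
  refine (conv_rapidDecay hf hgh).congr fun N => ?_
  simp only [conv, ← Finset.sum_sub_distrib, mul_sub]

/-! ### Symbols of weighted shifts -/

/-- The data of a weighted shift `ε_m ⊗ ε_n ↦ f(m) g(n) ε_{m+dm} ⊗ ε_{n+dn}`, where `n` is the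
distance of `m` to its upper end. The function `h` replaces `g` if the vectors with `n < 0` are
zero. -/
structure Symb (q : Set.Ioo (0 : ℝ) 1) where
  /-- The change of `m`. -/
  dm : ℤ
  /-- The change of `n`. -/
  dn : ℤ
  /-- The factor which depends on `m`. -/
  f : ℤ → ℂ
  /-- The factor which depends on `n`. -/
  g : ℤ → ℂ
  /-- The factor which depends on `n`, with truncation at `n = 0`. -/
  h : ℤ → ℂ
  /-- The limit of `f`. -/
  a : ℂ
  /-- The limit of `g` and `h`. -/
  b : ℂ
  hf : ExpConv q f a
  hg : ExpConv q g b
  hh : ExpConv q h b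
  -- Truncating at `n = 0` must not affect the constant term of the trace. Either `f` decays, or the
  -- untruncated weight already vanishes on each vector with `n ≥ 0` that would be moved to a
  -- negative `n`. Both alternatives pass to products.
  link : a = 0 ∨ ∀ n, 0 ≤ n → g n = if 0 ≤ n + dn then h n else 0

variable {q : Set.Ioo (0 : ℝ) 1}

/-- The symbol of the identity. -/
instance : One (Symb q) where
  one :=
    { dm := 0, dn := 0, f := fun _ => 1, g := fun _ => 1, h := fun _ => 1, a := 1, b := 1
      hf := .const _ _
      hg := .const _ _
      hh := .const _ _
      link := .inr fun n hn => by simp [hn] }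

theorem ExpConv.mul_ite {f g : ℤ → ℂ} {a b : ℂ} (hf : ExpConv q f a) (hg : ExpConv q g b) (d : ℤ) :
    ExpConv q (fun n => f n * if 0 ≤ n + d then g (n + d) else 0) (a * b) :=
  (hf.mul (hg.shift d)).congr (-d) fun n hn => by rw [if_pos (by omega)]

/-- The symbol of a product. -/
instance : Mul (Symb q) where
  mul D₁ D₂ :=
    { dm := D₂.dm + D₁.dm
      dn := D₂.dn + D₁.dn
      -- `D₂` acts first. An intermediate vector with negative `m` is zero both in the model and on
      -- the Hilbert space, so `f` carries a test; a negative `n` matters only on the Hilbert space,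
      -- so `h` carries one and `g` does not.
      f := fun m => D₂.f m * if 0 ≤ m + D₂.dm then D₁.f (m + D₂.dm) else 0
      g := fun n => D₂.g n * D₁.g (n + D₂.dn)
      h := fun n => D₂.h n * if 0 ≤ n + D₂.dn then D₁.h (n + D₂.dn) else 0
      a := D₂.a * D₁.a
      b := D₂.b * D₁.b
      hf := D₂.hf.mul_ite D₁.hf _
      hg := D₂.hg.mul (D₁.hg.shift _)
      hh := D₂.hh.mul_ite D₁.hh _
      link := by
        rcases D₁.link with h₁ | h₁
        · exact .inl (by rw [h₁, mul_zero])
        rcases D₂.link with h₂ | h₂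
        · exact .inl (by rw [h₂, zero_mul])
        -- The condition on `D₁` is needed only at `n + D₂.dn ≥ 0`, since otherwise the weight of
        -- `D₂` is already zero.
        refine .inr fun n hn => ?_
        rw [h₂ n hn, ← add_assoc]
        split_ifs with h3 h4
        · rw [h₁ _ h3, if_pos h4]
        · rw [h₁ _ h3, if_neg h4, mul_zero]
        · rw [zero_mul, mul_zero]
        · rw [zero_mul] }

/-- The symbols of `π'(a)`, `π'(b)`, `π'(a*)`, `π'(b*)`, with the sign `ε` in front of `π'(b)`. -/
def Symb.left (q : Set.Ioo (0 : ℝ) 1) (ε : ℂ) : AGen ⊕ AGen → Symb q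
  | .inl .a =>
    { dm := 1, dn := 0, f := fun m => qn q (m + 1), g := fun _ => 1, h := fun _ => 1, a := 1, b := 1
      hf := (expConv_qn q).shift 1
      hg := .const _ _
      hh := .const _ _
      link := .inr fun n hn => by simp [hn] }
  | .inl .b =>
    { dm := 0, dn := 1, f := fun m => ε * ((q ^ m : ℝ) : ℂ), g := fun _ => 1, h := fun _ => 1
      -- The limit is left unsimplified, as `ExpConv.mul` delivers it.
      a := ε * 0, b := 1
      hf := (ExpConv.const _ ε).mul (expConv_zpow q)
      hg := .const _ _
      hh := .const _ _
      link := .inl (mul_zero _) }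
  | .inr .a =>
    { dm := -1, dn := 0, f := fun m => qn q m, g := fun _ => 1, h := fun _ => 1, a := 1, b := 1
      hf := expConv_qn q
      hg := .const _ _
      hh := .const _ _
      link := .inr fun n hn => by simp [hn] }
  | .inr .b =>
    { dm := 0, dn := -1, f := fun m => ε * ((q ^ m : ℝ) : ℂ), g := fun _ => 1, h := fun _ => 1
      a := ε * 0, b := 1
      hf := (ExpConv.const _ ε).mul (expConv_zpow q)
      hg := .const _ _
      hh := .const _ _
      -- The second alternative fails here: at `n = 0` the weight `g` is 1 while `n + dn = -1`. The
      -- decay of `q^m` rescues this case.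
      link := .inl (mul_zero _) }

/-- The symbols of `π̂(a)`, `π̂(b)`, `π̂(a*)`, `π̂(b*)`, with the sign `ε` in front of `π̂(b)`. -/
def Symb.right (q : Set.Ioo (0 : ℝ) 1) (ε : ℂ) : AGen ⊕ AGen → Symb q
  | .inl .a =>
    { dm := 0, dn := 1, f := fun _ => 1, g := fun n => qn q (n + 1), h := fun n => qn q (n + 1)
      a := 1, b := 1
      hf := .const _ _
      hg := (expConv_qn q).shift 1
      hh := (expConv_qn q).shift 1
      link := .inr fun n hn => by rw [if_pos (by omega)] }
  | .inl .b =>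
    { dm := 1, dn := 0, f := fun _ => 1, g := fun n => ε * ((q ^ n : ℝ) : ℂ)
      h := fun n => ε * ((q ^ n : ℝ) : ℂ), a := 1, b := ε * 0
      hf := .const _ _
      hg := (ExpConv.const _ ε).mul (expConv_zpow q)
      hh := (ExpConv.const _ ε).mul (expConv_zpow q)
      link := .inr fun n hn => by rw [if_pos (by omega)] }
  | .inr .a =>
    { dm := 0, dn := -1, f := fun _ => 1, g := fun n => qn q n, h := fun n => qn q n, a := 1, b := 1
      hf := .const _ _
      hg := expConv_qn q
      hh := expConv_qn q
      link := .inr fun n hn => by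
        split_ifs with h
        · rfl
        -- Only `n = 0` is moved out of range, and there the weight is `q_0 = 0`.
        · obtain rfl : n = 0 := by omega
          simp [qn] }
  | .inr .b =>
    { dm := -1, dn := 0, f := fun _ => 1, g := fun n => ε * ((q ^ n : ℝ) : ℂ)
      h := fun n => ε * ((q ^ n : ℝ) : ℂ), a := 1, b := ε * 0
      hf := .const _ _
      hg := (ExpConv.const _ ε).mul (expConv_zpow q)
      hh := (ExpConv.const _ ε).mul (expConv_zpow q)
      link := .inr fun n hn => by rw [if_pos (by omega)] }

/-! ### The model operators -/

/-- `W` acts on the `ε_m ⊗ ε_k` as the weighted shift with symbol `D`. -/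
def ActsPlus (W : Module.End ℂ VPlus) (D : Symb q) : Prop :=
  ∀ (m : ℕ) (k : ℤ), W (Finsupp.single (m, k) 1) =
    (D.f m * D.g (k - m)) • epsPlus (m + D.dm) (k + (D.dm + D.dn))

/-- `W` acts on the `ε_l ⊗ ε_k ⊗ ε_s` as the weighted shift with symbol `D`. -/
def ActsMinus (W : Module.End ℂ VMinus) (D : Symb q) : Prop :=
  ∀ (l : ℕ) (k : ℤ) (s : Spin), W (Finsupp.single (l, k, s) 1) =
    (D.f l * D.g (k + s.sgn - l)) • epsMinus (l + D.dm) (k + (D.dm + D.dn)) s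

theorem ActsPlus.one : ActsPlus 1 (1 : Symb q) := fun m k => by
  change _ = ((1 : ℂ) * 1) • epsPlus (m + 0) (k + (0 + 0))
  simp [epsPlus]

theorem ActsMinus.one : ActsMinus 1 (1 : Symb q) := fun m k s => by
  change _ = ((1 : ℂ) * 1) • epsMinus (m + 0) (k + (0 + 0)) s
  simp [epsMinus]

theorem ActsPlus.mul {W₁ W₂ : Module.End ℂ VPlus} {D₁ D₂ : Symb q} (h₁ : ActsPlus W₁ D₁)
    (h₂ : ActsPlus W₂ D₂) : ActsPlus (W₁ * W₂) (D₁ * D₂) := fun m k => by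
  change W₁ (W₂ _) = ((D₂.f m * if 0 ≤ (m : ℤ) + D₂.dm then D₁.f (m + D₂.dm) else 0) *
    (D₂.g (k - m) * D₁.g (k - m + D₂.dn))) •
    epsPlus (m + (D₂.dm + D₁.dm)) (k + (D₂.dm + D₁.dm + (D₂.dn + D₁.dn)))
  rw [h₂, map_smul, epsPlus]
  split_ifs with h
  · rw [h₁, smul_smul, Int.toNat_of_nonneg h]
    congr 1
    · rw [show k + (D₂.dm + D₂.dn) - (m + D₂.dm) = k - m + D₂.dn by ring]
      ring
    · congr 1 <;> ring
  · simp

theorem ActsMinus.mul {W₁ W₂ : Module.End ℂ VMinus} {D₁ D₂ : Symb q} (h₁ : ActsMinus W₁ D₁)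
    (h₂ : ActsMinus W₂ D₂) : ActsMinus (W₁ * W₂) (D₁ * D₂) := fun m k s => by
  change W₁ (W₂ _) = ((D₂.f m * if 0 ≤ (m : ℤ) + D₂.dm then D₁.f (m + D₂.dm) else 0) *
    (D₂.g (k + s.sgn - m) * D₁.g (k + s.sgn - m + D₂.dn))) •
    epsMinus (m + (D₂.dm + D₁.dm)) (k + (D₂.dm + D₁.dm + (D₂.dn + D₁.dn))) s
  rw [h₂, map_smul, epsMinus]
  split_ifs with h
  · rw [h₁, smul_smul, Int.toNat_of_nonneg h]
    congr 1
    · rw [show k + (D₂.dm + D₂.dn) + s.sgn - (m + D₂.dm) = k + s.sgn - m + D₂.dn by ring]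
      ring
    · congr 1 <;> ring
  · simp

theorem actsPlus_piPlus (i : AGen ⊕ AGen) :
    ActsPlus (piPlus q (FreeAlgebra.ι ℂ i)) (Symb.left q 1 i) := fun m k => by
  rcases i with (_ | _) | (_ | _) <;>
    simp [piPlus, FreeStar.lift, opPlus, Symb.left, sub_eq_add_neg]

theorem actsPlus_piHatPlus (i : AGen ⊕ AGen) :
    ActsPlus (piHatPlus q (FreeAlgebra.ι ℂ i)) (Symb.right q (-1) i) := fun m k => by
  rcases i with (_ | _) | (_ | _) <;>
    simp [piHatPlus, FreeStar.lift, opPlus, Symb.right, sub_eq_add_neg, add_right_comm]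

theorem actsMinus_piMinus (i : AGen ⊕ AGen) :
    ActsMinus (piMinus q (FreeAlgebra.ι ℂ i)) (Symb.left q (-1) i) := fun m k s => by
  rcases i with (_ | _) | (_ | _) <;>
    simp [piMinus, FreeStar.lift, opMinus, Symb.left, sub_eq_add_neg]

theorem actsMinus_piHatMinus (i : AGen ⊕ AGen) :
    ActsMinus (piHatMinus q (FreeAlgebra.ι ℂ i)) (Symb.right q 1 i) := fun m k s => by
  rcases i with (_ | _) | (_ | _) <;>
    simp [piHatMinus, FreeStar.lift, opMinus, Symb.right, sub_eq_add_neg, add_right_comm]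

theorem trPlus_of_acts {W : Module.End ℂ VPlus} {D : Symb q} (h : ActsPlus W D) (N : ℕ) :
    trPlus N W = if D.dm = 0 ∧ D.dn = 0 then conv D.f D.g N else 0 := by
  split_ifs with hD
  · refine Finset.sum_congr rfl fun m _ => ?_
    rw [h, hD.1, hD.2]
    simp [epsPlus]
  · refine Finset.sum_eq_zero fun m _ => ?_
    rw [h, epsPlus]
    split_ifs with h0
    · rw [Finsupp.smul_apply, Finsupp.single_eq_of_ne, smul_zero]
      simp only [ne_eq, Prod.mk.injEq]
      omega
    · simp

/-- Evaluating at `k = N - σ` gives `n = k + σ - l = N - l`. The sum is the same convolution for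
both spins, hence `τ_0` does not depend on the choice of `s`. -/
theorem trMinus_of_acts {W : Module.End ℂ VMinus} {D : Symb q} (h : ActsMinus W D) (s : Spin)
    (N : ℕ) : trMinus s N W = if D.dm = 0 ∧ D.dn = 0 then conv D.f D.g N else 0 := by
  split_ifs with hD
  · refine Finset.sum_congr rfl fun m _ => ?_
    rw [h, hD.1, hD.2]
    simp [epsMinus]
  · refine Finset.sum_eq_zero fun m _ => ?_
    rw [h, epsMinus]
    split_ifs with h0
    · rw [Finsupp.smul_apply, Finsupp.single_eq_of_ne, smul_zero]
      simp only [ne_eq, Prod.mk.injEq]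
      omega
    · simp

/-! ### Asymptotics of traces -/

/-- The trace over the vectors with `m + n = N`, for the weighted shift with truncation. -/
def Symb.cutTrace (D : Symb q) (N : ℕ) : ℂ := if D.dm = 0 ∧ D.dn = 0 then conv D.f D.h N else 0

/-- The density of the trace. -/
def Symb.density (D : Symb q) : ℂ := if D.dm = 0 ∧ D.dn = 0 then D.a * D.b else 0

/-- A single `t` serves the model trace and the truncated trace. This is the bridge from `τ_0`,
defined in the model, to traces on the Hilbert space. -/
theorem Symb.exists_trace_asymptotics (D : Symb q) : ∃ t,
    RapidDecay (fun N => (if D.dm = 0 ∧ D.dn = 0 then conv D.f D.g N else 0) -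
      (((N : ℂ) + 1) * D.density + t)) ∧
    RapidDecay fun N => D.cutTrace N - (((N : ℂ) + 1) * D.density + t) := by
  by_cases hD : D.dm = 0 ∧ D.dn = 0
  · simp only [cutTrace, density, if_pos hD]
    obtain ⟨t, ht⟩ := exists_conv_rapidDecay D.hf D.hg
    refine ⟨t, ht, ?_⟩
    rcases D.link with ha | ha
    · have hf := D.hf
      rw [ha] at hf
      refine ((conv_sub_conv_rapidDecay hf D.hh D.hg).add ht).congr fun N => ?_
      simp only [Pi.add_apply]
      ring
    · refine ht.congr fun N => ?_
      congr 1
      refine Finset.sum_congr rfl fun m hm => ?_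
      have := Finset.mem_range.mp hm
      -- On the range of summation `n = N - m ≥ 0` and `dn = 0`, so `link` identifies `g` with `h`.
      rw [ha _ (by omega), hD.2, if_pos (by omega)]
  · refine ⟨0, ?_, ?_⟩ <;> simpa [cutTrace, density, hD] using RapidDecay.zero

/-! ### Spanning by words -/

/-- A submonoid containing the letters contains all words, and words span. Linear statements thus
reduce to properties that are stable under multiplication and hold for the letters. -/
theorem FreeStar.span_eq_top {G : Type} (S : Submonoid (FreeStar G))
    (hS : ∀ i, FreeAlgebra.ι ℂ i ∈ S) : Submodule.span ℂ (S : Set (FreeStar G)) = ⊤ := by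
  have h : Algebra.adjoin ℂ (S : Set (FreeStar G)) = ⊤ := by
    rw [eq_top_iff, ← FreeAlgebra.adjoin_range_ι]
    exact Algebra.adjoin_mono (Set.range_subset_iff.mpr hS)
  rw [← Submonoid.closure_eq S, ← Algebra.adjoin_eq_span, h, Algebra.top_toSubmodule]

theorem FreeStar.span_tmul_eq_top {G H : Type} (S : Submonoid (FreeStar G))
    (S' : Submonoid (FreeStar H)) (hS : ∀ i, FreeAlgebra.ι ℂ i ∈ S)
    (hS' : ∀ i, FreeAlgebra.ι ℂ i ∈ S') :
    Submodule.span ℂ (Set.image2 (fun x y => x ⊗ₜ[ℂ] y) (S : Set (FreeStar G))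
      (S' : Set (FreeStar H))) = ⊤ := by
  have h := Submodule.map₂_span_span ℂ (TensorProduct.mk ℂ (FreeStar G) (FreeStar H)) S S'
  rw [span_eq_top S hS, span_eq_top S' hS', TensorProduct.map₂_mk_top_top_eq_top] at h
  exact h.symm

/-! ### The functional `τ_1` -/

/-- `D` describes the action of a word under `π'_±`. -/
def IsLeft (w : FreeStar AGen) (D : Symb q) : Prop :=
  (∀ z : Circle, symbol w z = D.a * (z : ℂ) ^ D.dm) ∧ (D.a = 0 ∨ D.dn = 0) ∧ D.b = 1

/-- `D` describes the action of a word under `π̂_±`. -/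
def IsRight (w : FreeStar AGen) (D : Symb q) : Prop :=
  (∀ z : Circle, symbol w z = D.b * (z : ℂ) ^ D.dn) ∧ (D.b = 0 ∨ D.dm = 0) ∧ D.a = 1

theorem IsLeft.one : IsLeft 1 (1 : Symb q) := by
  refine ⟨fun z => ?_, .inr rfl, rfl⟩
  change _ = (1 : ℂ) * (z : ℂ) ^ (0 : ℤ)
  simp

theorem IsRight.one : IsRight 1 (1 : Symb q) := by
  refine ⟨fun z => ?_, .inr rfl, rfl⟩
  change _ = (1 : ℂ) * (z : ℂ) ^ (0 : ℤ)
  simp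

theorem IsLeft.mul {w₁ w₂ : FreeStar AGen} {D₁ D₂ : Symb q} (h₁ : IsLeft w₁ D₁)
    (h₂ : IsLeft w₂ D₂) : IsLeft (w₁ * w₂) (D₁ * D₂) := by
  refine ⟨fun z => ?_, ?_, ?_⟩
  · change _ = D₂.a * D₁.a * (z : ℂ) ^ (D₂.dm + D₁.dm)
    rw [map_mul, ContinuousMap.mul_apply, h₁.1, h₂.1, zpow_add₀ (Circle.coe_ne_zero z)]
    ring
  · change D₂.a * D₁.a = 0 ∨ D₂.dn + D₁.dn = 0
    rcases h₁.2.1 with h | h <;> rcases h₂.2.1 with h' | h' <;> simp [h, h']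
  · change D₂.b * D₁.b = 1
    rw [h₁.2.2, h₂.2.2, mul_one]

theorem IsRight.mul {w₁ w₂ : FreeStar AGen} {D₁ D₂ : Symb q} (h₁ : IsRight w₁ D₁)
    (h₂ : IsRight w₂ D₂) : IsRight (w₁ * w₂) (D₁ * D₂) := by
  refine ⟨fun z => ?_, ?_, ?_⟩
  · change _ = D₂.b * D₁.b * (z : ℂ) ^ (D₂.dn + D₁.dn)
    rw [map_mul, ContinuousMap.mul_apply, h₁.1, h₂.1, zpow_add₀ (Circle.coe_ne_zero z)]
    ring
  · change D₂.b * D₁.b = 0 ∨ D₂.dm + D₁.dm = 0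
    rcases h₁.2.1 with h | h <;> rcases h₂.2.1 with h' | h' <;> simp [h, h']
  · change D₂.a * D₁.a = 1
    rw [h₁.2.2, h₂.2.2, mul_one]

theorem isLeft_ι (ε : ℂ) (i : AGen ⊕ AGen) :
    IsLeft (FreeAlgebra.ι ℂ i) (Symb.left q ε i) := by
  rcases i with (_ | _) | (_ | _) <;>
    simp [IsLeft, Symb.left, symbol, FreeStar.lift]
  exacts [fun z => rfl, fun z => (Circle.coe_inv_eq_conj z).symm]

theorem isRight_ι (ε : ℂ) (i : AGen ⊕ AGen) :
    IsRight (FreeAlgebra.ι ℂ i) (Symb.right q ε i) := by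
  rcases i with (_ | _) | (_ | _) <;>
    simp [IsRight, Symb.right, symbol, FreeStar.lift]
  exacts [fun z => rfl, fun z => (Circle.coe_inv_eq_conj z).symm]

theorem tau1Base_of_monomial {w : FreeStar AGen} {a : ℂ} {d : ℤ}
    (h : ∀ z : Circle, symbol w z = a * (z : ℂ) ^ d) : tau1Base w = if d = 0 then a else 0 := by
  change (2 * Real.pi : ℂ)⁻¹ * ∫ θ in (0 : ℝ)..(2 * Real.pi), symbol w (Circle.exp θ) = _
  have hpi : (Real.pi : ℂ) ≠ 0 := Complex.ofReal_ne_zero.mpr Real.pi_ne_zero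
  simp only [h, intervalIntegral.integral_const_mul]
  split_ifs with hd
  · simp only [hd, zpow_zero, intervalIntegral.integral_const, sub_zero, Complex.real_smul]
    push_cast
    field_simp
  · have hd' : (d : ℂ) * Complex.I ≠ 0 := mul_ne_zero (Int.cast_ne_zero.mpr hd) Complex.I_ne_zero
    have h1 : ∀ θ : ℝ, (Circle.exp θ : ℂ) ^ d = Complex.exp (d * Complex.I * θ) := fun θ => by
      rw [Circle.coe_exp, ← Complex.exp_int_mul]
      congr 1
      ring
    simp only [h1]
    rw [integral_exp_mul_complex hd']
    have h2 : Complex.exp (d * Complex.I * ((2 * Real.pi : ℝ) : ℂ)) = 1 := by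
      rw [Complex.exp_eq_one_iff]
      exact ⟨d, by push_cast; ring⟩
    rw [h2]
    simp

/-- The symbol of a word is a monomial, and integration over the circle retains the exponent zero. A
left word with `a ≠ 0` has `dn = 0` and a right word with `b ≠ 0` has `dm = 0`, so the two exponent
conditions together say that the product shifts nothing. -/
theorem tau1_tmul {x y : FreeStar AGen} {D E : Symb q} (hx : IsLeft x D) (hy : IsRight y E) :
    tau1 (x ⊗ₜ y) = (D * E).density := by
  have h1 : tau1 (x ⊗ₜ y) = tau1Base x * tau1Base y := rfl
  rw [h1, tau1Base_of_monomial hx.1, tau1Base_of_monomial hy.1]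
  change _ = if E.dm + D.dm = 0 ∧ E.dn + D.dn = 0 then (E.a * D.a) * (E.b * D.b) else 0
  rw [hx.2.2, hy.2.2]
  rcases hx.2.1 with h | h <;> rcases hy.2.1 with h' | h' <;> simp [h, h']
  split_ifs <;> tauto

/-! ### The functional `τ_0` -/

/-- The words `x ⊗ y`, as far as `π'_+(x) π̂_+(y)` is concerned. -/
def IsPairPlus (w : PairAlg) (D : Symb q) : Prop :=
  ActsPlus (pairPlus q w) D ∧ tau1 w = D.density

/-- The words `x ⊗ y`, as far as `π'_-(x) π̂_-(y)` is concerned. -/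
def IsPairMinus (w : PairAlg) (D : Symb q) : Prop :=
  ActsMinus (pairMinus q w) D ∧ tau1 w = D.density

/-- `x` acts under `π'_+` as a weighted shift. -/
def IsLeftPlus (x : FreeStar AGen) (D : Symb q) : Prop := ActsPlus (piPlus q x) D ∧ IsLeft x D

/-- `x` acts under `π̂_+` as a weighted shift. -/
def IsRightPlus (x : FreeStar AGen) (D : Symb q) : Prop :=
  ActsPlus (piHatPlus q x) D ∧ IsRight x D

/-- `x` acts under `π'_-` as a weighted shift. -/
def IsLeftMinus (x : FreeStar AGen) (D : Symb q) : Prop := ActsMinus (piMinus q x) D ∧ IsLeft x D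

/-- `x` acts under `π̂_-` as a weighted shift. -/
def IsRightMinus (x : FreeStar AGen) (D : Symb q) : Prop :=
  ActsMinus (piHatMinus q x) D ∧ IsRight x D

theorem IsLeftPlus.one : IsLeftPlus 1 (1 : Symb q) :=
  ⟨by rw [map_one]; exact .one, .one⟩

theorem IsRightPlus.one : IsRightPlus 1 (1 : Symb q) :=
  ⟨by rw [map_one]; exact .one, .one⟩

theorem IsLeftMinus.one : IsLeftMinus 1 (1 : Symb q) :=
  ⟨by rw [map_one]; exact .one, .one⟩

theorem IsRightMinus.one : IsRightMinus 1 (1 : Symb q) :=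
  ⟨by rw [map_one]; exact .one, .one⟩

section mul
variable {x y : FreeStar AGen} {D E : Symb q}

theorem IsLeftPlus.mul (hx : IsLeftPlus x D) (hy : IsLeftPlus y E) : IsLeftPlus (x * y) (D * E) :=
  ⟨by rw [map_mul]; exact hx.1.mul hy.1, hx.2.mul hy.2⟩

theorem IsRightPlus.mul (hx : IsRightPlus x D) (hy : IsRightPlus y E) :
    IsRightPlus (x * y) (D * E) :=
  ⟨by rw [map_mul]; exact hx.1.mul hy.1, hx.2.mul hy.2⟩

theorem IsLeftMinus.mul (hx : IsLeftMinus x D) (hy : IsLeftMinus y E) :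
    IsLeftMinus (x * y) (D * E) :=
  ⟨by rw [map_mul]; exact hx.1.mul hy.1, hx.2.mul hy.2⟩

theorem IsRightMinus.mul (hx : IsRightMinus x D) (hy : IsRightMinus y E) :
    IsRightMinus (x * y) (D * E) :=
  ⟨by rw [map_mul]; exact hx.1.mul hy.1, hx.2.mul hy.2⟩

theorem IsLeftPlus.tmul (hx : IsLeftPlus x D) (hy : IsRightPlus y E) :
    IsPairPlus (x ⊗ₜ y) (D * E) :=
  ⟨hx.1.mul hy.1, tau1_tmul hx.2 hy.2⟩

theorem IsLeftMinus.tmul (hx : IsLeftMinus x D) (hy : IsRightMinus y E) :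
    IsPairMinus (x ⊗ₜ y) (D * E) :=
  ⟨hx.1.mul hy.1, tau1_tmul hx.2 hy.2⟩

end mul

theorem span_isPairPlus (q : Set.Ioo (0 : ℝ) 1) :
    Submodule.span ℂ {w : PairAlg | ∃ D : Symb q, IsPairPlus w D} = ⊤ := by
  rw [eq_top_iff, ← FreeStar.span_tmul_eq_top
    (⟨⟨{x | ∃ D : Symb q, IsLeftPlus x D}, fun ⟨_, h⟩ ⟨_, h'⟩ => ⟨_, h.mul h'⟩⟩, ⟨_, .one⟩⟩ :
      Submonoid (FreeStar AGen))
    (⟨⟨{x | ∃ D : Symb q, IsRightPlus x D}, fun ⟨_, h⟩ ⟨_, h'⟩ => ⟨_, h.mul h'⟩⟩, ⟨_, .one⟩⟩ :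
      Submonoid (FreeStar AGen))
    (fun i => ⟨_, actsPlus_piPlus i, isLeft_ι _ i⟩)
    (fun i => ⟨_, actsPlus_piHatPlus i, isRight_ι _ i⟩)]
  refine Submodule.span_mono (Set.image2_subset_iff.mpr ?_)
  rintro x ⟨D, hD⟩ y ⟨E, hE⟩
  exact ⟨_, hD.tmul hE⟩

theorem span_isPairMinus (q : Set.Ioo (0 : ℝ) 1) :
    Submodule.span ℂ {w : PairAlg | ∃ D : Symb q, IsPairMinus w D} = ⊤ := by
  rw [eq_top_iff, ← FreeStar.span_tmul_eq_top
    (⟨⟨{x | ∃ D : Symb q, IsLeftMinus x D}, fun ⟨_, h⟩ ⟨_, h'⟩ => ⟨_, h.mul h'⟩⟩, ⟨_, .one⟩⟩ :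
      Submonoid (FreeStar AGen))
    (⟨⟨{x | ∃ D : Symb q, IsRightMinus x D}, fun ⟨_, h⟩ ⟨_, h'⟩ => ⟨_, h.mul h'⟩⟩, ⟨_, .one⟩⟩ :
      Submonoid (FreeStar AGen))
    (fun i => ⟨_, actsMinus_piMinus i, isLeft_ι _ i⟩)
    (fun i => ⟨_, actsMinus_piHatMinus i, isRight_ι _ i⟩)]
  refine Submodule.span_mono (Set.image2_subset_iff.mpr ?_)
  rintro x ⟨D, hD⟩ y ⟨E, hE⟩
  exact ⟨_, hD.tmul hE⟩

/-- Limits of linear functionals, when the convergence is rapid on a spanning set. -/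
theorem exists_limit_functional {V ι : Type*} [AddCommGroup V] [Module ℂ V] [Nonempty ι]
    (M : ι → ℕ → V →ₗ[ℂ] ℂ) {S : Set V} (hS : Submodule.span ℂ S = ⊤)
    (h : ∀ w ∈ S, ∃ t, ∀ i, RapidDecay fun N => M i N w - t) :
    ∃ τ : V →ₗ[ℂ] ℂ, ∀ w i, RapidDecay fun N => M i N w - τ w := by
  have h1 : ∀ w : V, ∃ t, ∀ i, RapidDecay fun N => M i N w - t := by
    intro w
    have hw : w ∈ Submodule.span ℂ S := hS ▸ Submodule.mem_top
    induction hw using Submodule.span_induction with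
    | mem x hx => exact h x hx
    | zero => exact ⟨0, fun i => by simpa using RapidDecay.zero⟩
    | add x y _ _ hx hy =>
      obtain ⟨t, ht⟩ := hx
      obtain ⟨u, hu⟩ := hy
      refine ⟨t + u, fun i => ((ht i).add (hu i)).congr fun N => ?_⟩
      simp only [Pi.add_apply, map_add]
      ring
    | smul c x _ hx =>
      obtain ⟨t, ht⟩ := hx
      refine ⟨c * t, fun i => ((ht i).const_mul c).congr fun N => ?_⟩
      simp only [map_smul, smul_eq_mul]
      ring
  -- Limits are unique, so the chosen values depend linearly on `w`.
  choose t ht using h1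
  obtain ⟨i⟩ := ‹Nonempty ι›
  have hlim : ∀ w, Tendsto (fun N => M i N w) atTop (𝓝 (t w)) := fun w =>
    tendsto_sub_nhds_zero_iff.mp (ht w i).tendsto_zero
  refine ⟨{ toFun := t, map_add' := fun x y => ?_, map_smul' := fun c x => ?_ }, ht⟩
  · exact tendsto_nhds_unique (hlim _) (by simpa using (hlim x).add (hlim y))
  · exact tendsto_nhds_unique (hlim _) (by simpa using (hlim x).const_mul c)

/-- The functional `w ↦ Tr_N(w) - (N+1) τ_1(w)`. -/
def plusDefect (q : ℝ) (N : ℕ) : PairAlg →ₗ[ℂ] ℂ where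
  toFun w := trPlus N (pairPlus q w) - ((N : ℂ) + 1) * tau1 w
  map_add' x y := by
    simp only [trPlus, map_add, LinearMap.add_apply, Finsupp.add_apply, Finset.sum_add_distrib]
    ring
  map_smul' c x := by
    simp only [trPlus, map_smul, LinearMap.smul_apply, Finsupp.smul_apply, smul_eq_mul,
      ← Finset.mul_sum, RingHom.id_apply]
    ring

/-- The functional `w ↦ Tr_N^s(w) - (N+1) τ_1(w)`. -/
def minusDefect (q : ℝ) (s : Spin) (N : ℕ) : PairAlg →ₗ[ℂ] ℂ where
  toFun w := trMinus s N (pairMinus q w) - ((N : ℂ) + 1) * tau1 w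
  map_add' x y := by
    simp only [trMinus, map_add, LinearMap.add_apply, Finsupp.add_apply, Finset.sum_add_distrib]
    ring
  map_smul' c x := by
    simp only [trMinus, map_smul, LinearMap.smul_apply, Finsupp.smul_apply, smul_eq_mul,
      ← Finset.mul_sum, RingHom.id_apply]
    ring

theorem exists_tau0Plus (q : Set.Ioo (0 : ℝ) 1) : ∃ τ : PairAlg →ₗ[ℂ] ℂ, IsTau0Plus q τ := by
  obtain ⟨τ, hτ⟩ := exists_limit_functional (fun _ : Unit => plusDefect q) (span_isPairPlus q)
    (by
      rintro w ⟨D, hD, hw⟩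
      obtain ⟨t, ht, -⟩ := D.exists_trace_asymptotics
      refine ⟨t, fun _ => ht.congr fun N => ?_⟩
      rw [← trPlus_of_acts hD, ← hw, ← sub_sub]
      rfl)
  exact ⟨τ, fun w => tendsto_sub_nhds_zero_iff.mp (hτ w ()).tendsto_zero⟩

/-- The limit functional is built with `Spin` as index set, which forces one value for both spins.
-/
theorem exists_tau0Minus (q : Set.Ioo (0 : ℝ) 1) : ∃ τ : PairAlg →ₗ[ℂ] ℂ, IsTau0Minus q τ := by
  have : Nonempty Spin := ⟨.up⟩
  obtain ⟨τ, hτ⟩ := exists_limit_functional (minusDefect q) (span_isPairMinus q)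
    (by
      rintro w ⟨D, hD, hw⟩
      obtain ⟨t, ht, -⟩ := D.exists_trace_asymptotics
      refine ⟨t, fun s => ht.congr fun N => ?_⟩
      rw [← trMinus_of_acts hD s, ← hw, ← sub_sub]
      rfl)
  exact ⟨τ, fun s w => tendsto_sub_nhds_zero_iff.mp (hτ w s).tendsto_zero⟩

/-- Uniqueness of limits identifies `τ w` with the constant of the model trace, which is also the
constant of the truncated trace. -/
theorem IsPairPlus.cutTrace {τ : PairAlg →ₗ[ℂ] ℂ} (hτ : IsTau0Plus q τ) {w : PairAlg}
    {D : Symb q} (hw : IsPairPlus w D) :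
    RapidDecay fun N => D.cutTrace N - (((N : ℂ) + 1) * tau1 w + τ w) := by
  obtain ⟨t, h₁, h₂⟩ := D.exists_trace_asymptotics
  have h3 := hτ w
  simp only [trPlus_of_acts hw.1, hw.2] at h3
  rw [hw.2, tendsto_nhds_unique h3
    (tendsto_sub_nhds_zero_iff.mp (by simpa only [← sub_sub] using h₁.tendsto_zero))]
  exact h₂

theorem IsPairMinus.cutTrace {τ : PairAlg →ₗ[ℂ] ℂ} (hτ : IsTau0Minus q τ) {w : PairAlg}
    {D : Symb q} (hw : IsPairMinus w D) :
    RapidDecay fun N => D.cutTrace N - (((N : ℂ) + 1) * tau1 w + τ w) := by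
  obtain ⟨t, h₁, h₂⟩ := D.exists_trace_asymptotics
  have h3 := hτ .up w
  simp only [trMinus_of_acts hw.1, hw.2] at h3
  rw [hw.2, tendsto_nhds_unique h3
    (tendsto_sub_nhds_zero_iff.mp (by simpa only [← sub_sub] using h₁.tendsto_zero))]
  exact h₂

/-! ### Weighted shifts on the spinorial Hilbert space -/

open Classical in
/-- The basis vector with label `x`. -/
def siteVec (x : Site) : Hilb := lp.single 2 x 1

open Classical in
theorem siteVec_apply (x y : Site) : siteVec x y = if y = x then 1 else 0 := by
  rw [siteVec, lp.single_apply, Pi.single_apply]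

open Classical in
theorem inner_siteVec_left (x : Site) (ψ : Hilb) : inner ℂ (siteVec x) ψ = ψ x := by
  rw [siteVec, lp.inner_single_left]
  simp

theorem star_apply_siteVec (T : BH) (x y : Site) :
    star T (siteVec x) y = starRingEnd ℂ (T (siteVec y) x) := by
  rw [← inner_siteVec_left, ContinuousLinearMap.star_eq_adjoint,
    ContinuousLinearMap.adjoint_inner_right, ← inner_conj_symm, inner_siteVec_left]

open Classical in
/-- `T` maps the basis vector with label `x` to `c(x)` times the one with label `x + d`. -/
def IsShift (T : BH) (d : ℤ × ℤ × ℤ) (c : RawSite → ℂ) : Prop :=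
  ∀ x y : Site, T (siteVec x) y = if y.1 = x.1.shift d then c x.1 else 0

theorem RawSite.shift_shift (x : RawSite) (d e : ℤ × ℤ × ℤ) :
    (x.shift d).shift e = x.shift (d + e) := by
  simp [RawSite.shift, add_assoc]

theorem RawSite.shift_zero (x : RawSite) : x.shift 0 = x := by
  simp [RawSite.shift]

theorem RawSite.eq_shift_iff (x y : RawSite) (d : ℤ × ℤ × ℤ) :
    y = x.shift d ↔ x = y.shift (-d) := by
  constructor <;> rintro rfl <;> simp [shift_shift, shift_zero]

/-- Weights matter only where both the source and the target label are admissible. -/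
theorem IsShift.congr {T : BH} {d d' : ℤ × ℤ × ℤ} {c c' : RawSite → ℂ} (h : IsShift T d c)
    (hd : d = d') (hc : ∀ x, IsSite x → IsSite (x.shift d) → c x = c' x) : IsShift T d' c' := by
  subst hd
  intro x y
  rw [h]
  split_ifs with hy
  · exact hc _ x.2 (hy ▸ y.2)
  · rfl

theorem isShift_shiftOp (d : ℤ × ℤ × ℤ) (c : ℤ → ℤ → ℝ)
    (hc : ∀ m l, 0 ≤ m → 0 ≤ l → |c m l| ≤ 1) :
    IsShift (shiftOp d c hc) d (fun x => (c x.2.2.1 x.2.2.2 : ℂ)) := by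
  intro x y
  change (siteSub d y).elim 0 (fun z => ((c z.1.2.2.1 z.1.2.2.2 : ℝ) : ℂ) * siteVec x z) = _
  have hiff := RawSite.eq_shift_iff x.1 y.1 d
  rw [siteSub]
  split_ifs with h h1 h1
  · simp [siteVec_apply, ← hiff.mp h1]
  · simp [siteVec_apply, Subtype.ext_iff, Ne.symm (fun h' => h1 (hiff.mpr h'))]
  · exact absurd (hiff.mp h1 ▸ x.2) h
  · rfl

theorem IsShift.star {T : BH} {d : ℤ × ℤ × ℤ} {c : RawSite → ℂ} (h : IsShift T d c) :
    IsShift (star T) (-d) (fun x => starRingEnd ℂ (c (x.shift (-d)))) := by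
  intro x y
  rw [star_apply_siteVec, h]
  have hiff := RawSite.eq_shift_iff y.1 x.1 d
  by_cases hy : x.1 = y.1.shift d
  · rw [if_pos hy, if_pos (hiff.mp hy)]
    dsimp only
    rw [← hiff.mp hy]
  · rw [if_neg hy, if_neg (fun h' => hy (hiff.mpr h')), map_zero]

open Classical in
theorem apply_of_isShift {T : BH} {d : ℤ × ℤ × ℤ} {c : RawSite → ℂ} (h : IsShift T d c) (x : Site) :
    T (siteVec x) = if hx : IsSite (x.1.shift d) then c x.1 • siteVec ⟨_, hx⟩ else 0 := by
  ext y
  rw [h]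
  split_ifs with hy hx hx
  · simp [siteVec_apply, ← hy]
  · exact absurd (hy ▸ y.2 : IsSite _) hx
  · simp [siteVec_apply, Subtype.ext_iff, hy]
  · rfl

open Classical in
theorem IsShift.mul {T₁ T₂ : BH} {d₁ d₂ : ℤ × ℤ × ℤ} {c₁ c₂ : RawSite → ℂ} (h₁ : IsShift T₁ d₁ c₁)
    (h₂ : IsShift T₂ d₂ c₂) : IsShift (T₁ * T₂) (d₂ + d₁)
      (fun x => if IsSite (x.shift d₂) then c₂ x * c₁ (x.shift d₂) else 0) := by
  intro x y
  rw [mul_apply_eq_comp, apply_of_isShift h₂]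
  dsimp only
  by_cases hx : IsSite (x.1.shift d₂)
  · rw [dif_pos hx, if_pos hx, map_smul, lp.coeFn_smul, Pi.smul_apply, h₁, RawSite.shift_shift]
    split_ifs <;> simp
  · rw [dif_neg hx, if_neg hx, map_zero]
    split_ifs <;> rfl

/-- The reflection of labels, before restriction to the labels of basis vectors. -/
def RawSite.flip (x : RawSite) : RawSite := (x.1, x.2.1, x.2.1 - x.2.2.1, x.2.1 + x.1.sgn - x.2.2.2)

/-- The change of labels corresponding to `d` under the reflection. -/
def flipShift (d : ℤ × ℤ × ℤ) : ℤ × ℤ × ℤ := (d.1, d.1 - d.2.1, d.1 - d.2.2)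

theorem RawSite.flip_eq_shift_iff (x y : RawSite) (d : ℤ × ℤ × ℤ) :
    y.flip = x.flip.shift d ↔ y = x.shift (flipShift d) := by
  obtain ⟨s, k, m, l⟩ := x
  obtain ⟨s', k', m', l'⟩ := y
  obtain ⟨a, b, c⟩ := d
  simp only [RawSite.flip, RawSite.shift, flipShift, Prod.mk.injEq, Prod.mk_add_mk]
  constructor <;> rintro ⟨rfl, h1, h2, h3⟩ <;> refine ⟨rfl, ?_, ?_, ?_⟩ <;> omega

theorem J_apply (ψ : Hilb) (y : Site) :
    J ψ y = phase (siteFlip y) * starRingEnd ℂ (ψ (siteFlip y)) := rfl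

theorem J_symm_siteVec (x : Site) :
    J.symm (siteVec x) = phase (siteFlip x) • siteVec (siteFlip x) := by
  ext y
  change phase y * starRingEnd ℂ (siteVec x (siteFlip y)) = phase (siteFlip x) * siteVec _ y
  have h : siteFlip y = x ↔ y = siteFlip x :=
    ⟨fun h => by rw [← h, siteFlip_siteFlip], fun h => by rw [h, siteFlip_siteFlip]⟩
  rw [siteVec_apply, siteVec_apply]
  by_cases hy : y = siteFlip x
  · rw [if_pos hy, if_pos (h.mpr hy), hy, map_one]
  · rw [if_neg hy, if_neg (fun h' => hy (h.mp h')), map_zero, mul_zero, mul_zero]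

theorem conjJ_apply_siteVec (T : BH) (x y : Site) : conjJ T (siteVec x) y =
    phase (siteFlip y) * starRingEnd ℂ (phase (siteFlip x)) *
      starRingEnd ℂ (T (siteVec (siteFlip x)) (siteFlip y)) := by
  change J (T (J.symm (siteVec x))) y = _
  rw [J_symm_siteVec, map_smul, J_apply, lp.coeFn_smul, Pi.smul_apply, smul_eq_mul, map_mul]
  ring

/-- The exponent of `i` changes by `2 (d.2.1 + d.2.2)` on the upper component, and by the negative
of this plus a multiple of 4 on the lower one. The resulting sign is independent of the label, so
conjugation by `J` preserves weighted shifts. -/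
theorem phase_shift {x y : Site} {d : ℤ × ℤ × ℤ} (h : y.1 = x.1.shift d) :
    phase y * starRingEnd ℂ (phase x) = (-1) ^ (d.2.1 + d.2.2) := by
  have hI : (starRingEnd ℂ) Complex.I = Complex.I⁻¹ := by simp
  have h2 : (Complex.I : ℂ) ^ (2 : ℤ) = -1 := by
    rw [← Complex.I_sq]; rfl
  have h4 : (Complex.I : ℂ) ^ (4 : ℤ) = 1 := by
    rw [← Complex.I_pow_four]; rfl
  rw [phase, phase, map_zpow₀, hI, inv_zpow', ← zpow_add₀ Complex.I_ne_zero]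
  obtain ⟨⟨s, k, m, l⟩, hx⟩ := x
  obtain ⟨⟨s', k', m', l'⟩, hy⟩ := y
  obtain ⟨a, b, c⟩ := d
  simp only [RawSite.shift, Prod.mk.injEq, Prod.mk_add_mk] at h
  obtain ⟨rfl, rfl, rfl, rfl⟩ := h
  cases s' with
  | up =>
    rw [← h2, ← zpow_mul]
    congr 1
    simp only [phaseExp]
    ring
  | down =>
    -- The factor `i^(4a) = 1` is inserted to account for the change of `4 · 2j` in the lower
    -- exponent.
    rw [← inv_neg_one, inv_zpow', ← h2, ← zpow_mul, ← one_mul (Complex.I ^ (2 * _)),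
      ← one_zpow a, ← h4, ← zpow_mul, ← zpow_add₀ Complex.I_ne_zero]
    congr 1
    simp only [phaseExp]
    ring

theorem IsShift.conjJ {T : BH} {d : ℤ × ℤ × ℤ} {c : RawSite → ℂ} (h : IsShift T d c) :
    IsShift (conjJ T) (flipShift d)
      (fun x => (-1) ^ (d.2.1 + d.2.2) * starRingEnd ℂ (c x.flip)) := by
  intro x y
  rw [conjJ_apply_siteVec, h]
  have hf : ∀ z : Site, (siteFlip z).1 = z.1.flip := fun z => rfl
  have hiff := RawSite.flip_eq_shift_iff x.1 y.1 d
  rw [hf, hf]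
  split_ifs with h1 h2 h2
  · rw [phase_shift (d := d) (by rw [hf, hf, h1])]
  · exact absurd (hiff.mp h1) h2
  · exact absurd (hiff.mpr h2) h1
  · simp

/-- `T` acts as `c` times the tensor product of the weighted shifts with symbols `D` and `E`, with
truncation. -/
def ActsSite (T : BH) (c : ℂ) (D E : Symb q) : Prop :=
  D.dm + D.dn = E.dm + E.dn ∧ IsShift T (D.dm + D.dn, D.dm, E.dm) fun x =>
    c * (D.f x.2.2.1 * D.h (x.2.1 - x.2.2.1)) * (E.f x.2.2.2 * E.h (x.2.1 + x.1.sgn - x.2.2.2))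

open Classical in
theorem ActsSite.one : ActsSite 1 1 (1 : Symb q) (1 : Symb q) := by
  refine ⟨rfl, fun x y => ?_⟩
  change siteVec x y = if y.1 = x.1.shift 0 then 1 * ((1 : ℂ) * 1) * (1 * 1) else 0
  rw [siteVec_apply, RawSite.shift_zero]
  simp [Subtype.ext_iff]

/-- The equality of `dm + dn` for the two legs says that both change `2j` by the same amount, which
keeps the coordinates of the legs consistent under composition. -/
theorem ActsSite.mul {T₁ T₂ : BH} {c₁ c₂ : ℂ} {D₁ D₂ E₁ E₂ : Symb q} (h₁ : ActsSite T₁ c₁ D₁ E₁)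
    (h₂ : ActsSite T₂ c₂ D₂ E₂) : ActsSite (T₁ * T₂) (c₁ * c₂) (D₁ * D₂) (E₁ * E₂) := by
  refine ⟨?_, (h₁.2.mul h₂.2).congr ?_ ?_⟩
  · change D₂.dm + D₁.dm + (D₂.dn + D₁.dn) = E₂.dm + E₁.dm + (E₂.dn + E₁.dn)
    linarith [h₁.1, h₂.1]
  · change _ = (D₂.dm + D₁.dm + (D₂.dn + D₁.dn), D₂.dm + D₁.dm, E₂.dm + E₁.dm)
    simp only [Prod.mk_add_mk, Prod.mk.injEq, and_true]
    ring
  · rintro ⟨s, k, m, l⟩ - -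
    have e := h₂.1
    change _ = c₁ * c₂ * ((D₂.f m * if 0 ≤ m + D₂.dm then D₁.f (m + D₂.dm) else 0) *
        (D₂.h (k - m) * if 0 ≤ k - m + D₂.dn then D₁.h (k - m + D₂.dn) else 0)) *
      ((E₂.f l * if 0 ≤ l + E₂.dm then E₁.f (l + E₂.dm) else 0) *
        (E₂.h (k + s.sgn - l) * if 0 ≤ k + s.sgn - l + E₂.dn then
          E₁.h (k + s.sgn - l + E₂.dn) else 0))
    -- Admissibility of the intermediate label splits into the two tests of each leg, exactly those
    -- built into the product of symbols.
    have hs : IsSite (RawSite.shift (s, k, m, l) (D₂.dm + D₂.dn, D₂.dm, E₂.dm)) ↔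
        (0 ≤ m + D₂.dm ∧ 0 ≤ k - m + D₂.dn) ∧ 0 ≤ l + E₂.dm ∧ 0 ≤ k + s.sgn - l + E₂.dn := by
      simp only [RawSite.shift, Prod.mk_add_mk, IsSite]
      omega
    by_cases H : IsSite (RawSite.shift (s, k, m, l) (D₂.dm + D₂.dn, D₂.dm, E₂.dm))
    · rw [if_pos H, if_pos (hs.mp H).1.1, if_pos (hs.mp H).1.2, if_pos (hs.mp H).2.1,
        if_pos (hs.mp H).2.2]
      simp only [RawSite.shift, Prod.mk_add_mk]
      rw [show k + (D₂.dm + D₂.dn) - (m + D₂.dm) = k - m + D₂.dn by ring,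
        show k + (D₂.dm + D₂.dn) + s.sgn - (l + E₂.dm) = k + s.sgn - l + E₂.dn by linarith]
      ring
    · rw [if_neg H]
      rw [hs, not_and_or, not_and_or, not_and_or] at H
      rcases H with (H | H) | (H | H) <;> simp [H]

/-! ### Words in `a_±`, `b_±` and their reflections -/

/-- The first leg of a generator under `rho`. -/
def fstLetter : XGen ⊕ XGen → AGen ⊕ AGen
  | .inl .aPlus => .inl .a
  | .inl .aMinus => .inr .b
  | .inl .bPlus => .inl .a
  | .inl .bMinus => .inr .b
  | .inr .aPlus => .inr .a
  | .inr .aMinus => .inl .b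
  | .inr .bPlus => .inr .a
  | .inr .bMinus => .inl .b

/-- The second leg of a generator under `rho`. -/
def sndLetter : XGen ⊕ XGen → AGen ⊕ AGen
  | .inl .aPlus => .inl .a
  | .inl .aMinus => .inr .b
  | .inl .bPlus => .inl .b
  | .inl .bMinus => .inr .a
  | .inr .aPlus => .inr .a
  | .inr .aMinus => .inl .b
  | .inr .bPlus => .inr .b
  | .inr .bMinus => .inl .a

/-- The coefficient of a generator under `rho`. -/
def rhoCoeff (q : ℝ) : XGen ⊕ XGen → ℂ
  | .inl .aPlus => 1
  | .inl .aMinus => -q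
  | .inl .bPlus => -1
  | .inl .bMinus => -1
  | .inr .aPlus => 1
  | .inr .aMinus => -q
  | .inr .bPlus => -1
  | .inr .bMinus => -1

theorem rho_ι (q : ℝ) (i : XGen ⊕ XGen) : rho q (FreeAlgebra.ι ℂ i) =
    rhoCoeff q i • (FreeAlgebra.ι ℂ (fstLetter i) ⊗ₜ FreeAlgebra.ι ℂ (sndLetter i)) := by
  rcases i with (_ | _ | _ | _) | (_ | _ | _ | _) <;>
    simp [rho, FreeStar.lift, rhoGen, rhoGenStar, rhoCoeff, fstLetter, sndLetter, FreeStar.gen,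
      FreeStar.genStar]
  all_goals exact (neg_one_smul ℂ _).symm

theorem zpow_add_ofReal (q : Set.Ioo (0 : ℝ) 1) (m n : ℤ) :
    ((q : ℝ) : ℂ) ^ (m + n) = ((q : ℝ) : ℂ) ^ m * ((q : ℝ) : ℂ) ^ n :=
  zpow_add₀ (Complex.ofReal_ne_zero.mpr q.2.1.ne') m n

/-- The weights of `a_±`, `b_±` depend on `m` and `l` alone, so left symbols suffice. The signs and
the `q` of `rhoCoeff` match: for `a_-`, `(-q) · q^m · (-q^l) = q^(m+l+1)`. -/
theorem actsSite_xOp (i : XGen ⊕ XGen) : ActsSite (evalStar (xOp q) (FreeAlgebra.ι ℂ i))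
    (rhoCoeff q i) (Symb.left q 1 (fstLetter i)) (Symb.left q (-1) (sndLetter i)) := by
  rcases i with (_ | _ | _ | _) | (_ | _ | _ | _) <;>
    simp only [evalStar, FreeStar.lift, FreeAlgebra.lift_ι_apply, Sum.elim_inl, Sum.elim_inr, xOp]
  case inl.aPlus =>
    refine ⟨rfl, (isShift_shiftOp _ _ _).congr rfl fun x _ _ => ?_⟩
    simp [rhoCoeff, fstLetter, sndLetter, Symb.left]
  case inl.aMinus =>
    refine ⟨rfl, (isShift_shiftOp _ _ _).congr rfl fun x _ _ => ?_⟩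
    simp [rhoCoeff, fstLetter, sndLetter, Symb.left, zpow_add_ofReal]
    ring
  case inl.bPlus =>
    refine ⟨rfl, (isShift_shiftOp _ _ _).congr rfl fun x _ _ => ?_⟩
    simp [rhoCoeff, fstLetter, sndLetter, Symb.left, mul_comm]
  case inl.bMinus =>
    refine ⟨rfl, (isShift_shiftOp _ _ _).congr rfl fun x _ _ => ?_⟩
    simp [rhoCoeff, fstLetter, sndLetter, Symb.left]
  case inr.aPlus =>
    refine ⟨rfl, (isShift_shiftOp _ _ _).star.congr rfl fun x _ _ => ?_⟩
    simp [rhoCoeff, fstLetter, sndLetter, Symb.left, RawSite.shift]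
  case inr.aMinus =>
    refine ⟨rfl, (isShift_shiftOp _ _ _).star.congr rfl fun x _ _ => ?_⟩
    simp [rhoCoeff, fstLetter, sndLetter, Symb.left, RawSite.shift, zpow_add_ofReal]
    ring
  case inr.bPlus =>
    refine ⟨rfl, (isShift_shiftOp _ _ _).star.congr rfl fun x _ _ => ?_⟩
    simp [rhoCoeff, fstLetter, sndLetter, Symb.left, RawSite.shift, mul_comm]
  case inr.bMinus =>
    refine ⟨rfl, (isShift_shiftOp _ _ _).star.congr rfl fun x _ _ => ?_⟩
    simp [rhoCoeff, fstLetter, sndLetter, Symb.left, RawSite.shift]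

/-- The reflection replaces `m`, `l` by `n`, `n'`, so the weights become right symbols. The sign
from `phase_shift` is `-1` for `b_±` and `1` for `a_±`, which accounts for the signs of `π̂_±(b)`.
-/
theorem actsSite_conjJ_xOp (i : XGen ⊕ XGen) :
    ActsSite (evalStar (fun g => conjJ (xOp q g)) (FreeAlgebra.ι ℂ i))
      (rhoCoeff q i) (Symb.right q (-1) (fstLetter i)) (Symb.right q 1 (sndLetter i)) := by
  rcases i with (_ | _ | _ | _) | (_ | _ | _ | _) <;>
    simp only [evalStar, FreeStar.lift, FreeAlgebra.lift_ι_apply, Sum.elim_inl, Sum.elim_inr, xOp]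
  case inl.aPlus =>
    refine ⟨rfl, (isShift_shiftOp _ _ _).conjJ.congr rfl fun x _ _ => ?_⟩
    simp [rhoCoeff, fstLetter, sndLetter, Symb.right, RawSite.flip]
  case inl.aMinus =>
    refine ⟨rfl, (isShift_shiftOp _ _ _).conjJ.congr rfl fun x _ _ => ?_⟩
    simp [rhoCoeff, fstLetter, sndLetter, Symb.right, RawSite.flip, zpow_add_ofReal]
    ring
  case inl.bPlus =>
    refine ⟨rfl, (isShift_shiftOp _ _ _).conjJ.congr rfl fun x _ _ => ?_⟩
    simp [rhoCoeff, fstLetter, sndLetter, Symb.right, RawSite.flip, mul_comm]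
  case inl.bMinus =>
    refine ⟨rfl, (isShift_shiftOp _ _ _).conjJ.congr rfl fun x _ _ => ?_⟩
    simp [rhoCoeff, fstLetter, sndLetter, Symb.right, RawSite.flip]
  case inr.aPlus =>
    refine ⟨rfl, (isShift_shiftOp _ _ _).conjJ.star.congr rfl fun x _ _ => ?_⟩
    simp [rhoCoeff, fstLetter, sndLetter, Symb.right, RawSite.flip, RawSite.shift, flipShift]
    congr 3 <;> ring
  case inr.aMinus =>
    refine ⟨rfl, (isShift_shiftOp _ _ _).conjJ.star.congr rfl fun x _ _ => ?_⟩
    simp [rhoCoeff, fstLetter, sndLetter, Symb.right, RawSite.flip, RawSite.shift, flipShift,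
      zpow_add_ofReal]
    rw [show x.2.1 + 1 + x.1.sgn - (x.2.2.2 + 1) = x.2.1 + x.1.sgn - x.2.2.2 by ring]
    ring
  case inr.bPlus =>
    refine ⟨rfl, (isShift_shiftOp _ _ _).conjJ.star.congr rfl fun x _ _ => ?_⟩
    simp [rhoCoeff, fstLetter, sndLetter, Symb.right, RawSite.flip, RawSite.shift, flipShift]
    rw [show x.2.1 + -1 + x.1.sgn - (x.2.2.2 + -1) = x.2.1 + x.1.sgn - x.2.2.2 by ring,
      show x.2.1 + -1 - x.2.2.1 + 1 = x.2.1 - x.2.2.1 by ring, mul_comm]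
  case inr.bMinus =>
    refine ⟨rfl, (isShift_shiftOp _ _ _).conjJ.star.congr rfl fun x _ _ => ?_⟩
    simp [rhoCoeff, fstLetter, sndLetter, Symb.right, RawSite.flip, RawSite.shift, flipShift]
    left
    congr 1
    ring

/-- `x` is a scalar multiple of a word, acting as a polynomial in `a_±`, `b_±`. -/
def IsSiteLeft (q : Set.Ioo (0 : ℝ) 1) (x : FreeStar XGen) : Prop :=
  ∃ (c : ℂ) (D E : Symb q) (u v : FreeStar AGen), ActsSite (evalStar (xOp q) x) c D E ∧
    rho q x = c • (u ⊗ₜ v) ∧ IsLeftPlus u D ∧ IsLeftMinus v E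

/-- `y` is a scalar multiple of a word, acting as a polynomial in the reflections of
`a_±`, `b_±`. -/
def IsSiteRight (q : Set.Ioo (0 : ℝ) 1) (y : FreeStar XGen) : Prop :=
  ∃ (c : ℂ) (D E : Symb q) (u v : FreeStar AGen),
    ActsSite (evalStar (fun g => conjJ (xOp q g)) y) c D E ∧
    rho q y = c • (u ⊗ₜ v) ∧ IsRightPlus u D ∧ IsRightMinus v E

/-- `P` is a scalar multiple of a product of words. -/
def IsSiteWord (q : Set.Ioo (0 : ℝ) 1) (P : FreeStar XGen ⊗[ℂ] FreeStar XGen) : Prop :=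
  ∃ (c : ℂ) (D E : Symb q) (u v : PairAlg), ActsSite (realize q P) c D E ∧
    rhoTilde q P = c • (u ⊗ₜ v) ∧ IsPairPlus u D ∧ IsPairMinus v E

theorem IsSiteLeft.one : IsSiteLeft q 1 :=
  ⟨1, 1, 1, 1, 1, by rw [map_one]; exact .one,
    by rw [map_one, one_smul, Algebra.TensorProduct.one_def], .one, .one⟩

theorem IsSiteRight.one : IsSiteRight q 1 :=
  ⟨1, 1, 1, 1, 1, by rw [map_one]; exact .one,
    by rw [map_one, one_smul, Algebra.TensorProduct.one_def], .one, .one⟩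

theorem IsSiteLeft.mul {x y : FreeStar XGen} (hx : IsSiteLeft q x) (hy : IsSiteLeft q y) :
    IsSiteLeft q (x * y) := by
  obtain ⟨c, D, E, u, v, h1, h2, h3, h4⟩ := hx
  obtain ⟨c', D', E', u', v', h1', h2', h3', h4'⟩ := hy
  refine ⟨c * c', D * D', E * E', u * u', v * v', ?_, ?_, h3.mul h3', h4.mul h4'⟩
  · rw [map_mul]
    exact h1.mul h1'
  · rw [map_mul, h2, h2', smul_mul_smul_comm, Algebra.TensorProduct.tmul_mul_tmul]

theorem IsSiteRight.mul {x y : FreeStar XGen} (hx : IsSiteRight q x) (hy : IsSiteRight q y) :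
    IsSiteRight q (x * y) := by
  obtain ⟨c, D, E, u, v, h1, h2, h3, h4⟩ := hx
  obtain ⟨c', D', E', u', v', h1', h2', h3', h4'⟩ := hy
  refine ⟨c * c', D * D', E * E', u * u', v * v', ?_, ?_, h3.mul h3', h4.mul h4'⟩
  · rw [map_mul]
    exact h1.mul h1'
  · rw [map_mul, h2, h2', smul_mul_smul_comm, Algebra.TensorProduct.tmul_mul_tmul]

theorem isSiteLeft_ι (i : XGen ⊕ XGen) : IsSiteLeft q (FreeAlgebra.ι ℂ i) :=
  ⟨_, _, _, _, _, actsSite_xOp i, rho_ι q i, ⟨actsPlus_piPlus _, isLeft_ι _ _⟩,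
    ⟨actsMinus_piMinus _, isLeft_ι _ _⟩⟩

theorem isSiteRight_ι (i : XGen ⊕ XGen) : IsSiteRight q (FreeAlgebra.ι ℂ i) :=
  ⟨_, _, _, _, _, actsSite_conjJ_xOp i, rho_ι q i, ⟨actsPlus_piHatPlus _, isRight_ι _ _⟩,
    ⟨actsMinus_piHatMinus _, isRight_ι _ _⟩⟩

theorem IsSiteLeft.tmul {x y : FreeStar XGen} (hx : IsSiteLeft q x) (hy : IsSiteRight q y) :
    IsSiteWord q (x ⊗ₜ y) := by
  obtain ⟨c, D, E, u, v, h1, h2, h3, h4⟩ := hx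
  obtain ⟨c', D', E', u', v', h1', h2', h3', h4'⟩ := hy
  refine ⟨c * c', D * D', E * E', u ⊗ₜ u', v ⊗ₜ v', h1.mul h1', ?_, h3.tmul h3', h4.tmul h4'⟩
  change TensorProduct.tensorTensorTensorComm ℂ _ _ _ _ (rho q x ⊗ₜ rho q y) = _
  rw [h2, h2', TensorProduct.smul_tmul_smul, map_smul,
    TensorProduct.tensorTensorTensorComm_tmul]

theorem span_isSiteWord (q : Set.Ioo (0 : ℝ) 1) :
    Submodule.span ℂ {P | IsSiteWord q P} = ⊤ := by
  rw [eq_top_iff, ← FreeStar.span_tmul_eq_top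
    (⟨⟨{x | IsSiteLeft q x}, .mul⟩, .one⟩ : Submonoid (FreeStar XGen))
    (⟨⟨{x | IsSiteRight q x}, .mul⟩, .one⟩ : Submonoid (FreeStar XGen))
    isSiteLeft_ι isSiteRight_ι]
  exact Submodule.span_mono (Set.image2_subset_iff.mpr fun x hx y hy => hx.tmul hy)

/-! ### Sums of diagonal matrix entries -/

/-- The labels with `|D| = p + 3/2`. -/
abbrev LevelIndex (p : ℕ) := Fin (p + 1) × Fin (p + 2) ⊕ Fin (p + 2) × Fin (p + 1)

/-- The labels with `|D| = p + 3/2`: those of `v^{j↑}_{m,l}` with `2j = p` and of `v^{j↓}_{m,l}`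
with `2j = p + 1`. -/
def levelSite (p : ℕ) : LevelIndex p → Site
  | .inl (m, l) => ⟨(.up, p, (m : ℕ), (l : ℕ)), by
      refine ⟨?_, ?_, ?_, ?_⟩ <;> simp only [Spin.sgn] <;> omega⟩
  | .inr (m, l) => ⟨(.down, p + 1, (m : ℕ), (l : ℕ)), by
      refine ⟨?_, ?_, ?_, ?_⟩ <;> simp only [Spin.sgn] <;> omega⟩

/-- The labels, grouped by the value of `|D|`. -/
def levelEquiv : (Σ p, LevelIndex p) ≃ Site :=
  Equiv.ofBijective (fun i => levelSite i.1 i.2) (by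
    constructor
    · rintro ⟨p, ⟨m, l⟩ | ⟨m, l⟩⟩ ⟨p', ⟨m', l'⟩ | ⟨m', l'⟩⟩ h <;>
        replace h := congrArg Subtype.val h <;>
        simp only [levelSite, Prod.mk.injEq, reduceCtorEq, false_and, true_and] at h
      all_goals
        obtain ⟨h1, h2, h3⟩ := h
        obtain rfl : p = p' := by omega
        have hm : m = m' := by omega
        have hl : l = l' := by omega
        rw [hm, hl]
    · rintro ⟨⟨s, k, m, l⟩, h1, h2, h3, h4⟩
      cases s <;> simp only [Spin.sgn] at h1 h2 h3 h4
      · refine ⟨⟨k.toNat, .inl (⟨m.toNat, by omega⟩, ⟨l.toNat, by omega⟩)⟩, ?_⟩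
        apply Subtype.ext
        simp only [levelSite, Prod.mk.injEq, true_and]
        omega
      · refine ⟨⟨(k - 1).toNat, .inr (⟨m.toNat, by omega⟩, ⟨l.toNat, by omega⟩)⟩, ?_⟩
        apply Subtype.ext
        simp only [levelSite, Prod.mk.injEq, true_and]
        omega)

theorem abs_diracEigenvalue_levelSite (p : ℕ) (i : LevelIndex p) :
    |diracEigenvalue (levelSite p i)| = p + 3 / 2 := by
  rcases i with ⟨m, l⟩ | ⟨m, l⟩
  · simp only [levelSite, diracEigenvalue, Int.cast_natCast]
    exact abs_of_nonneg (by positivity)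
  · simp only [levelSite, diracEigenvalue]
    push_cast
    rw [abs_of_nonpos (by linarith [(Nat.cast_nonneg p : (0 : ℝ) ≤ p)])]
    ring

/-- The sum of the diagonal matrix entries of `T` over the labels with `|D| = p + 3/2`. -/
def levelTrace (p : ℕ) : BH →ₗ[ℂ] ℂ where
  toFun T := ∑ i, T (siteVec (levelSite p i)) (levelSite p i)
  map_add' T T' := by simp [Finset.sum_add_distrib]
  map_smul' c T := (Finset.mul_sum _ _ c).symm

theorem levelTrace_apply (p : ℕ) (T : BH) :
    levelTrace p T = ∑ i, T (siteVec (levelSite p i)) (levelSite p i) := rfl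

theorem sum_fin_prod (F G : ℕ → ℂ) (a b : ℕ) : ∑ i : Fin a × Fin b, F i.1 * G i.2 =
    (∑ m ∈ Finset.range a, F m) * ∑ l ∈ Finset.range b, G l := by
  rw [Finset.sum_range, Finset.sum_range, Finset.sum_mul_sum, Fintype.sum_prod_type]

/-- On the upper block `m + n = p` and `l + n' = p + 1`; on the lower block, where `2j = p + 1`, the
two sums are exchanged. In each block `m` and `l` vary independently, so the sum factors. -/
theorem levelTrace_of_actsSite {T : BH} {c : ℂ} {D E : Symb q} (h : ActsSite T c D E) (p : ℕ) :
    levelTrace p T = c * (D.cutTrace p * E.cutTrace (p + 1) +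
      D.cutTrace (p + 1) * E.cutTrace p) := by
  rw [levelTrace_apply]
  have hd : ∀ x : Site, x.1 = x.1.shift (D.dm + D.dn, D.dm, E.dm) ↔
      (D.dm = 0 ∧ D.dn = 0) ∧ E.dm = 0 ∧ E.dn = 0 := by
    rintro ⟨⟨s, k, m, l⟩, hx⟩
    have := h.1
    simp only [RawSite.shift, Prod.mk.injEq, Prod.mk_add_mk]
    constructor
    · rintro ⟨-, h1, h2, h3⟩
      omega
    · rintro ⟨⟨h1, h2⟩, h3, h4⟩
      refine ⟨trivial, ?_, ?_, ?_⟩ <;> omega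
  by_cases hD : D.dm = 0 ∧ D.dn = 0
  · by_cases hE : E.dm = 0 ∧ E.dn = 0
    · simp only [h.2 _ _, if_pos ((hd _).mpr ⟨hD, hE⟩), Symb.cutTrace, if_pos hD, if_pos hE, conv,
        Fintype.sum_sum_type, levelSite, mul_add]
      congr 1
      · rw [← sum_fin_prod (fun m : ℕ => D.f m * D.h ((p : ℤ) - m))
          (fun l : ℕ => E.f l * E.h (((p + 1 : ℕ) : ℤ) - l)), Finset.mul_sum]
        refine Finset.sum_congr rfl fun i _ => ?_
        simp only [Spin.sgn]
        push_cast
        ring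
      · rw [← sum_fin_prod (fun m : ℕ => D.f m * D.h (((p + 1 : ℕ) : ℤ) - m))
          (fun l : ℕ => E.f l * E.h ((p : ℤ) - l)), Finset.mul_sum]
        refine Finset.sum_congr rfl fun i _ => ?_
        have h1 : ((p : ℤ) + 1) + Spin.down.sgn - ((i.2 : ℕ) : ℤ) = p - ((i.2 : ℕ) : ℤ) := by
          simp only [Spin.sgn]
          ring
        rw [h1]
        push_cast
        ring
    · rw [Finset.sum_eq_zero fun i _ => ?_]
      · simp [Symb.cutTrace, hE]
      · rw [h.2, if_neg fun h' => hE ((hd _).mp h').2]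
  · rw [Finset.sum_eq_zero fun i _ => ?_]
    · simp [Symb.cutTrace, hD]
    · rw [h.2, if_neg fun h' => hD ((hd _).mp h').1]

/-- Here `fg - uv = (f-u) v + u (g-v) + (f-u)(g-v)`, and rapid decay absorbs the affine growth of
`u` and `v`. -/
theorem RapidDecay.mul_sub_mul {f g u v : ℕ → ℂ} {a b c d : ℂ}
    (hu : ∀ n : ℕ, u n = n * a + b) (hv : ∀ n : ℕ, v n = n * c + d)
    (hf : RapidDecay fun n => f n - u n) (hg : RapidDecay fun n => g n - v n) :
    RapidDecay fun n => f n * g n - u n * v n := by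
  refine ((((hf.param_mul.mul_const c).add (hf.mul_const d)).add
    ((hg.param_mul.mul_const a).add (hg.mul_const b))).add (hf.mul hg)).congr fun n => ?_
  simp only [Pi.add_apply, Pi.mul_apply, hu, hv]
  ring

/-- The level sums of `T ∈ X X̂` are a quadratic polynomial in `|D|`, up to a rapidly decreasing
sequence. -/
theorem levelTrace_asymptotics {τ₀p τ₀m : PairAlg →ₗ[ℂ] ℂ} (hp : IsTau0Plus q τ₀p)
    (hm : IsTau0Minus q τ₀m) (P : FreeStar XGen ⊗[ℂ] FreeStar XGen) :
    RapidDecay fun p => levelTrace p (realize q P) -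
      (2 * tensorFun tau1 tau1 (rhoTilde q P) * ((p : ℂ) + 3 / 2) ^ 2 +
        2 * (tensorFun τ₀p tau1 + tensorFun tau1 τ₀m) (rhoTilde q P) * ((p : ℂ) + 3 / 2) +
        2 * (tensorFun τ₀p τ₀m - (1 / 4 : ℂ) • tensorFun tau1 tau1) (rhoTilde q P)) := by
  have hP : P ∈ Submodule.span ℂ {P | IsSiteWord q P} := span_isSiteWord q ▸ Submodule.mem_top
  induction hP using Submodule.span_induction with
  | mem P h =>
    obtain ⟨c, D, E, u, v, h1, h2, h3, h4⟩ := h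
    have hD := h3.cutTrace hp
    have hE := h4.cutTrace hm
    have hup := RapidDecay.mul_sub_mul (a := tau1 u) (b := tau1 u + τ₀p u) (c := tau1 v)
      (d := 2 * tau1 v + τ₀m v) (fun n => by ring) (fun n => by push_cast; ring) hD hE.comp_succ
    have hdown := RapidDecay.mul_sub_mul (a := tau1 u) (b := 2 * tau1 u + τ₀p u) (c := tau1 v)
      (d := tau1 v + τ₀m v) (fun n => by push_cast; ring) (fun n => by ring) hD.comp_succ hE
    -- In terms of `x = p + 3/2` the densities are multiplied by `x - 1/2` and `x + 1/2`. Adding the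
    -- two orders cancels the odd corrections, and `(x - 1/2)(x + 1/2) = x² - 1/4` yields the term
    -- `-1/4`.
    refine ((hup.add hdown).const_mul c).congr fun p => ?_
    have ht : ∀ σ τ : PairAlg →ₗ[ℂ] ℂ, tensorFun σ τ (u ⊗ₜ v) = σ u * τ v := fun σ τ => rfl
    simp only [levelTrace_of_actsSite h1, h2, map_smul, LinearMap.add_apply, LinearMap.sub_apply,
      LinearMap.smul_apply, ht, Pi.add_apply, smul_eq_mul]
    push_cast
    ring
  | zero => simpa using RapidDecay.zero
  | add P P' _ _ h h' =>
    refine (h.add h').congr fun p => ?_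
    simp only [Pi.add_apply, map_add]
    ring
  | smul c P _ h =>
    refine (h.const_mul c).congr fun p => ?_
    simp only [map_smul, smul_eq_mul]
    ring

/-! ### Traces -/

/-- This follows from Parseval and `αβ ≤ α² + β²`. The crude bound suffices because it does not
depend on the basis. -/
theorem HilbertBasis.summable_norm_inner_mul {κ : Type} (e : HilbertBasis κ ℂ Hilb) (u v : Hilb) :
    Summable (fun i => ‖inner ℂ u (e i)‖ * ‖inner ℂ (e i) v‖) ∧
      ∑' i, ‖inner ℂ u (e i)‖ * ‖inner ℂ (e i) v‖ ≤ ‖u‖ ^ 2 + ‖v‖ ^ 2 := by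
  have hsq : ∀ w : Hilb, HasSum (fun i => ‖inner ℂ (e i) w‖ ^ 2) (‖w‖ ^ 2) := fun w => by
    have h := Complex.hasSum_re (e.hasSum_inner_mul_inner w w)
    rw [inner_self_eq_norm_sq_to_K] at h
    convert! h using 1
    · ext i
      refine Eq.trans ?_ (inner_mul_symm_re_eq_norm (𝕜 := ℂ) w (e i)).symm
      rw [norm_mul, ← inner_conj_symm w, RCLike.norm_conj, sq]
    · norm_cast
  have h := (hsq u).add (hsq v)
  have hle : ∀ i, ‖inner ℂ u (e i)‖ * ‖inner ℂ (e i) v‖ ≤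
      ‖inner ℂ (e i) u‖ ^ 2 + ‖inner ℂ (e i) v‖ ^ 2 := fun i => by
    rw [← inner_conj_symm u, RCLike.norm_conj]
    nlinarith [sq_nonneg (‖inner ℂ (e i) u‖ - ‖inner ℂ (e i) v‖),
      sq_nonneg ‖inner ℂ (e i) u‖, sq_nonneg ‖inner ℂ (e i) v‖]
  have hs := Summable.of_nonneg_of_le (fun i => by positivity) hle h.summable
  exact ⟨hs, (hs.tsum_le_tsum hle h.summable).trans h.tsum_eq.le⟩

open Classical in
theorem norm_siteVec (x : Site) : ‖siteVec x‖ = 1 := by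
  rw [siteVec, lp.norm_single (by norm_num), norm_one]

open Classical in
theorem hasSum_siteVec (ψ : Hilb) : HasSum (fun x => ψ x • siteVec x) ψ := by
  convert! lp.hasSum_single (by simp) ψ using 1
  ext1 x
  rw [siteVec, ← lp.single_smul, smul_eq_mul, mul_one]

/-- The trace of `T D`, for a summable diagonal operator `D`. -/
theorem hasTrace_mul_of_diagonal (T D : BH) (μ : Site → ℂ) (hD : ∀ ψ x, D ψ x = μ x * ψ x)
    (hμ : Summable fun x => ‖μ x‖) :
    HasTrace (T * D) (∑' x, μ x * T (siteVec x) x) := by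
  intro κ e
  have h1 : ∀ i, HasSum (fun x => μ x * (inner ℂ (siteVec x) (e i) *
      inner ℂ (e i) (T (siteVec x)))) (inner ℂ (e i) ((T * D) (e i))) := by
    intro i
    have h := ((hasSum_siteVec (D (e i))).mapL T).mapL (innerSL ℂ (e i))
    rw [mul_apply_eq_comp]
    convert! h using 1
    ext x
    simp only [map_smul, innerSL_apply_apply, smul_eq_mul, hD, inner_siteVec_left]
    ring
  have h2 : ∀ x, HasSum (fun i => μ x * (inner ℂ (siteVec x) (e i) *
      inner ℂ (e i) (T (siteVec x)))) (μ x * T (siteVec x) x) := by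
    intro x
    have h := (e.hasSum_inner_mul_inner (siteVec x) (T (siteVec x))).mul_left (μ x)
    rwa [inner_siteVec_left] at h
  -- Absolute summability of the double family permits both orders of summation: over `κ` first it
  -- gives the diagonal entries of `T`, over `Site` first the diagonal of `T * D` in the basis `e`.
  have h3 : Summable fun p : Site × κ => μ p.1 * (inner ℂ (siteVec p.1) (e p.2) *
      inner ℂ (e p.2) (T (siteVec p.1))) := by
    refine Summable.of_norm ?_
    rw [summable_prod_of_nonneg fun _ => norm_nonneg _]
    simp only [norm_mul]
    refine ⟨fun x => (HilbertBasis.summable_norm_inner_mul e _ _).1.mul_left _, ?_⟩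
    simp only [tsum_mul_left]
    refine Summable.of_nonneg_of_le (fun x => ?_) (fun x => ?_) (hμ.mul_right (1 + ‖T‖ ^ 2))
    · exact mul_nonneg (norm_nonneg _) (tsum_nonneg fun _ => by positivity)
    · refine mul_le_mul_of_nonneg_left
        ((HilbertBasis.summable_norm_inner_mul e _ _).2.trans ?_) (norm_nonneg _)
      have h4 := T.le_opNorm (siteVec x)
      rw [norm_siteVec, mul_one] at h4
      rw [norm_siteVec, one_pow]
      gcongr
  have h4 := h3.hasSum
  have h5 := h4.prod_fiberwise h2
  have h6 := ((Equiv.prodComm κ Site).hasSum_iff.mpr h4).prod_fiberwise h1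
  rwa [← h5.tsum_eq] at h6

theorem absDiracPow_apply (s : ℂ) (hs : 0 ≤ s.re) (ψ : Hilb) (x : Site) :
    absDiracPow s hs ψ x = ((|diracEigenvalue x| : ℝ) : ℂ) ^ (-s) * ψ x := rfl

/-- Level `p` has `2 (p+1)(p+2) ≤ 2 (p + 3/2)²` labels, hence the threshold 3. -/
theorem summable_absDirac_cpow {s : ℂ} (hs : 3 < s.re) :
    Summable fun x : Site => ‖((|diracEigenvalue x| : ℝ) : ℂ) ^ (-s)‖ := by
  have hnn : ∀ i, 0 ≤ ((fun x : Site => ‖((|diracEigenvalue x| : ℝ) : ℂ) ^ (-s)‖) ∘ levelEquiv) i :=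
    fun _ => norm_nonneg _
  rw [← levelEquiv.summable_iff, summable_sigma_of_nonneg hnn]
  refine ⟨fun p => Summable.of_finite, ?_⟩
  have h : Summable fun n : ℕ => 2 * (1 / |(n : ℝ) + 3 / 2| ^ (s.re - 2)) :=
    ((Real.summable_one_div_nat_add_rpow _ _).mpr (by linarith)).mul_left 2
  refine Summable.of_nonneg_of_le (fun p => tsum_nonneg fun _ => norm_nonneg _) (fun p => ?_) h
  have hp : (0 : ℝ) < p + 3 / 2 := by positivity
  have h1 : ∀ i : LevelIndex p,
      ‖((|diracEigenvalue (levelEquiv ⟨p, i⟩)| : ℝ) : ℂ) ^ (-s)‖ = ((p : ℝ) + 3 / 2) ^ (-s.re) := by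
    intro i
    change ‖((|diracEigenvalue (levelSite p i)| : ℝ) : ℂ) ^ (-s)‖ = _
    rw [abs_diracEigenvalue_levelSite, Complex.norm_cpow_eq_rpow_re_of_pos hp, Complex.neg_re]
  simp only [Function.comp_apply, h1, tsum_fintype, Finset.sum_const, Finset.card_univ,
    nsmul_eq_mul, Fintype.card_sum, Fintype.card_prod, Fintype.card_fin]
  rw [abs_of_pos hp, one_div, ← Real.rpow_neg hp.le, neg_sub, sub_eq_add_neg, Real.rpow_add hp,
    Real.rpow_two, ← mul_assoc]
  refine mul_le_mul_of_nonneg_right ?_ (Real.rpow_nonneg hp.le _)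
  push_cast
  nlinarith

/-- The zeta function of `T` is a Dirichlet series in the level sums of `T`. -/
theorem hasTrace_mul_absDiracPow (T : BH) {s : ℂ} (hs : 3 < s.re) (hs' : 0 ≤ s.re) :
    HasTrace (T * absDiracPow s hs') (∑' p : ℕ, ((p : ℂ) + 3 / 2) ^ (-s) * levelTrace p T) := by
  have h := hasTrace_mul_of_diagonal T _ _ (absDiracPow_apply s hs') (summable_absDirac_cpow hs)
  convert! h using 1
  have hsum : Summable fun x : Site =>
      ((|diracEigenvalue x| : ℝ) : ℂ) ^ (-s) * T (siteVec x) x := by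
    refine ((summable_absDirac_cpow hs).mul_right ‖T‖).of_norm_bounded fun x => ?_
    rw [norm_mul]
    refine mul_le_mul_of_nonneg_left ?_ (norm_nonneg _)
    refine (lp.norm_apply_le_norm (by norm_num) _ x).trans ((T.le_opNorm _).trans ?_)
    rw [norm_siteVec, mul_one]
  refine Eq.trans ?_ ((levelEquiv.summable_iff.mpr hsum).tsum_sigma.symm.trans
    (levelEquiv.tsum_eq fun x : Site =>
      ((|diracEigenvalue x| : ℝ) : ℂ) ^ (-s) * T (siteVec x) x))
  refine tsum_congr fun p => ?_
  rw [tsum_fintype, levelTrace_apply, Finset.mul_sum]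
  refine Finset.sum_congr rfl fun i _ => ?_
  change _ = ((|diracEigenvalue (levelSite p i)| : ℝ) : ℂ) ^ (-s) * _
  rw [abs_diracEigenvalue_levelSite]
  push_cast
  rfl

/-! ### Dirichlet series -/

theorem RapidDecay.summable_mul_pow {E : ℕ → ℂ} (hE : RapidDecay E) (A : ℕ) :
    Summable fun p : ℕ => ‖E p‖ * ((p : ℝ) + 3 / 2) ^ A := by
  have hg : Summable fun p : ℕ => 1 / (p : ℝ) ^ 2 :=
    Real.summable_one_div_nat_pow.mpr one_lt_two
  -- For `p ≥ 1` one has `p + 3/2 ≤ 3p`, whence `3^A`; decay of order `A + 2` leaves `p^(-2)`.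
  refine summable_of_isBigO_nat hg (Asymptotics.IsBigO.of_bound (3 ^ A) ?_)
  have h1 : ∀ᶠ p : ℕ in atTop, ‖(p : ℂ) ^ (A + 2) * E p‖ < 1 :=
    (tendsto_zero_iff_norm_tendsto_zero.mp (hE (A + 2))).eventually_lt_const one_pos
  filter_upwards [h1, eventually_ge_atTop 1] with p hp hp1
  have hp1' : (1 : ℝ) ≤ p := by exact_mod_cast hp1
  rw [norm_mul, norm_pow, Complex.norm_natCast] at hp
  rw [norm_mul, norm_norm, norm_pow, Real.norm_of_nonneg (by positivity : (0 : ℝ) ≤ p + 3 / 2),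
    norm_div, norm_one, norm_pow, Real.norm_natCast, mul_one_div, le_div_iff₀ (by positivity)]
  calc ‖E p‖ * ((p : ℝ) + 3 / 2) ^ A * (p : ℝ) ^ 2
      ≤ ‖E p‖ * (3 * (p : ℝ)) ^ A * (p : ℝ) ^ 2 := by
        gcongr
        linarith
    _ = 3 ^ A * ((p : ℝ) ^ (A + 2) * ‖E p‖) := by ring
    _ ≤ 3 ^ A * 1 := by gcongr
    _ = 3 ^ A := mul_one _

theorem norm_add_cpow_neg_le (p : ℕ) {s : ℂ} {A : ℕ} (hs : -s.re ≤ A) :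
    ‖((p : ℂ) + 3 / 2) ^ (-s)‖ ≤ ((p : ℝ) + 3 / 2) ^ A := by
  have h : ((p : ℂ) + 3 / 2) = (((p : ℝ) + 3 / 2 : ℝ) : ℂ) := by push_cast; rfl
  have hp : (0 : ℝ) ≤ p := Nat.cast_nonneg p
  rw [h, Complex.norm_cpow_eq_rpow_re_of_pos (by positivity), ← Real.rpow_natCast]
  exact Real.rpow_le_rpow_of_exponent_le (by linarith) hs

theorem RapidDecay.summable_cpow {E : ℕ → ℂ} (hE : RapidDecay E) (s : ℂ) :
    Summable fun p : ℕ => ((p : ℂ) + 3 / 2) ^ (-s) * E p := by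
  obtain ⟨A, hA⟩ := exists_nat_ge (-s.re)
  refine (hE.summable_mul_pow A).of_norm_bounded fun p => ?_
  rw [norm_mul, mul_comm]
  exact mul_le_mul_of_nonneg_left (norm_add_cpow_neg_le p hA) (norm_nonneg _)

theorem add_three_halves_ne_zero (p : ℕ) : (p : ℂ) + 3 / 2 ≠ 0 := by
  have h : ((p : ℂ) + 3 / 2) = (((p : ℝ) + 3 / 2 : ℝ) : ℂ) := by push_cast; rfl
  rw [h, Complex.ofReal_ne_zero]
  positivity

/-- Around `s₀` the series is dominated uniformly on the half-plane `Re s > Re s₀ - 1` by a summable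
sequence. -/
theorem RapidDecay.differentiable_tsum {E : ℕ → ℂ} (hE : RapidDecay E) :
    Differentiable ℂ fun s : ℂ => ∑' p : ℕ, ((p : ℂ) + 3 / 2) ^ (-s) * E p := by
  intro s₀
  obtain ⟨A, hA⟩ := exists_nat_ge (1 - s₀.re)
  have hU : IsOpen {s : ℂ | s₀.re - 1 < s.re} := isOpen_lt continuous_const Complex.continuous_re
  have h := Complex.differentiableOn_tsum_of_summable_norm (hE.summable_mul_pow A)
    (F := fun (p : ℕ) (s : ℂ) => ((p : ℂ) + 3 / 2) ^ (-s) * E p) (U := {s : ℂ | s₀.re - 1 < s.re})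
    (fun p => by
      refine Differentiable.differentiableOn fun s => ?_
      exact (differentiableAt_id.neg.const_cpow (.inl (add_three_halves_ne_zero p))).mul_const _)
    hU (fun p s hs => by
      rw [norm_mul, mul_comm]
      refine mul_le_mul_of_nonneg_left (norm_add_cpow_neg_le p ?_) (norm_nonneg _)
      have : s₀.re - 1 < s.re := hs
      linarith)
  exact h.differentiableAt (hU.mem_nhds (by simp))

/-- The difference between `∑_{d = 3/2, 5/2, …} d^{-s}` and `ζ(s)`. -/
def zetaDefect (s : ℂ) : ℂ :=
  HurwitzZeta.hurwitzZeta ((1 / 2 : ℝ) : UnitAddCircle) s - riemannZeta s - (1 / 2 : ℂ) ^ (-s)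

/-- The poles at 1 of the two zeta functions cancel, `ζ` being the Hurwitz zeta function with
parameter 0. -/
theorem differentiable_zetaDefect : Differentiable ℂ zetaDefect := by
  have h := HurwitzZeta.differentiable_hurwitzZeta_sub_hurwitzZeta
    ((1 / 2 : ℝ) : UnitAddCircle) 0
  rw [HurwitzZeta.hurwitzZeta_zero] at h
  exact h.sub fun s => differentiableAt_id.neg.const_cpow (.inl (by norm_num))

theorem hasSum_add_cpow_neg {s : ℂ} (hs : 1 < s.re) :
    HasSum (fun p : ℕ => ((p : ℂ) + 3 / 2) ^ (-s)) (riemannZeta s + zetaDefect s) := by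
  have h := HurwitzZeta.hasSum_hurwitzZeta_of_one_lt_re (a := 1 / 2) (by norm_num) hs
  rw [← hasSum_nat_add_iff' 1] at h
  convert! h using 1
  · ext p
    rw [Complex.cpow_neg, one_div]
    congr 2
    push_cast
    ring
  · rw [zetaDefect, Finset.sum_range_one, Complex.cpow_neg]
    push_cast
    rw [zero_add, one_div ((1 / 2 : ℂ) ^ s)]
    ring

theorem hasSum_pow_mul_cpow_neg {s : ℂ} (n : ℕ) (hs : 1 + n < s.re) :
    HasSum (fun p : ℕ => ((p : ℂ) + 3 / 2) ^ (-s) * ((p : ℂ) + 3 / 2) ^ n)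
      (riemannZeta (s - n) + zetaDefect (s - n)) := by
  have h : 1 < (s - n).re := by
    rw [Complex.sub_re, Complex.natCast_re]
    linarith
  convert! hasSum_add_cpow_neg h using 1
  ext p
  rw [neg_sub, sub_eq_neg_add, Complex.cpow_add _ _ (add_three_halves_ne_zero p),
    Complex.cpow_natCast]

/-- The zeta function of `T`, if the level sums of `T` are a quadratic polynomial in `|D|` up to a
rapidly decreasing sequence. -/
theorem exists_hasTrace_zeta {T : BH} {A B C : ℂ}
    (hT : RapidDecay fun p => levelTrace p T -
      (A * ((p : ℂ) + 3 / 2) ^ 2 + B * ((p : ℂ) + 3 / 2) + C)) :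
    ∃ h : ℂ → ℂ, Differentiable ℂ h ∧ ∀ s : ℂ, 3 < s.re → ∀ hs' : 0 ≤ s.re,
      HasTrace (T * absDiracPow s hs')
        (A * riemannZeta (s - 2) + B * riemannZeta (s - 1) + C * riemannZeta s + h s) := by
  set E : ℕ → ℂ := fun p => levelTrace p T -
    (A * ((p : ℂ) + 3 / 2) ^ 2 + B * ((p : ℂ) + 3 / 2) + C) with hE
  refine ⟨fun s => A * zetaDefect (s - 2) + B * zetaDefect (s - 1) + C * zetaDefect s +
    ∑' p : ℕ, ((p : ℂ) + 3 / 2) ^ (-s) * E p, ?_, fun s hs hs' => ?_⟩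
  · refine (((Differentiable.const_mul ?_ A).add (Differentiable.const_mul ?_ B)).add
      (differentiable_zetaDefect.const_mul C)).add hT.differentiable_tsum
    · exact differentiable_zetaDefect.comp (differentiable_id.sub_const 2)
    · exact differentiable_zetaDefect.comp (differentiable_id.sub_const 1)
  · convert! hasTrace_mul_absDiracPow T hs hs' using 1
    have h2 := (hasSum_pow_mul_cpow_neg 2 (s := s) (by norm_num; linarith)).mul_left A
    have h1 := (hasSum_pow_mul_cpow_neg 1 (s := s) (by norm_num; linarith)).mul_left B
    have h0 := (hasSum_pow_mul_cpow_neg 0 (s := s) (by norm_num; linarith)).mul_left C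
    have h3 := (((h2.add h1).add h0).add (hT.summable_cpow s).hasSum).tsum_eq
    refine Eq.trans ?_ (h3.symm.trans (tsum_congr fun p => ?_))
    · push_cast
      simp only [sub_zero]
      ring
    · simp only [hE]
      ring

/-! ### Residues -/

/-- The function `w F(w)`, completed by `c` at 0, is continuous, and Cauchy's formula at the centre
of the disc gives its value there. Differentiability may fail at the single point 0. -/
theorem hasResidueAt_zero {F : ℂ → ℂ} {c : ℂ} (hd : ∀ᶠ w in 𝓝[≠] 0, DifferentiableAt ℂ F w)
    (hl : Tendsto (fun w => w * F w) (𝓝[≠] 0) (𝓝 c)) : HasResidueAt F 0 c := by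
  obtain ⟨R, hR, hball⟩ := Metric.eventually_nhds_iff_ball.mp (eventually_nhdsWithin_iff.mp hd)
  filter_upwards [Ioo_mem_nhdsGT hR] with r hr
  set G : ℂ → ℂ := Function.update (fun w => w * F w) 0 c with hG
  have hGd : ∀ w ∈ Metric.ball (0 : ℂ) R \ {0}, DifferentiableAt ℂ G w := by
    rintro w ⟨hw, hw0⟩
    refine (differentiableAt_id.mul (hball w hw hw0)).congr_of_eventuallyEq ?_
    filter_upwards [isOpen_ne.mem_nhds hw0] with z hz
    exact Function.update_of_ne hz _ _
  have hGc : ContinuousOn G (Metric.closedBall 0 r) := by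
    intro w hw
    by_cases hw0 : w = 0
    · subst hw0
      exact (continuousAt_update_same.mpr hl).continuousWithinAt
    · exact (hGd w ⟨Metric.closedBall_subset_ball hr.2 hw, hw0⟩).continuousAt.continuousWithinAt
  have h := Complex.two_pi_I_inv_smul_circleIntegral_sub_inv_smul_of_differentiable_on_off_countable
    (Set.countable_singleton (0 : ℂ)) (Metric.mem_ball_self hr.1) hGc
    (fun w hw => hGd w ⟨Metric.ball_subset_ball hr.2.le hw.1, hw.2⟩)
  rw [hG, Function.update_self, smul_eq_mul] at h
  rw [← h]
  congr 1
  refine circleIntegral.integral_congr hr.1.le fun w hw => ?_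
  have hw0 : w ≠ 0 := by
    rintro rfl
    simp [hr.1.ne] at hw
  simp only [Function.update_of_ne hw0, sub_zero, smul_eq_mul]
  rw [inv_mul_cancel_left₀ hw0]

theorem differentiableAt_zeta_add {s m : ℂ} (h : s + m ≠ 1) :
    DifferentiableAt ℂ (fun w => riemannZeta (w + m)) s :=
  (differentiableAt_riemannZeta h).comp s (differentiableAt_id.add_const m)

theorem eventually_differentiableAt_zeta_add (m : ℂ) :
    ∀ᶠ w in 𝓝[≠] (0 : ℂ), DifferentiableAt ℂ (fun w => riemannZeta (w + m)) w := by
  by_cases hm : m = 1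
  · filter_upwards [self_mem_nhdsWithin] with w hw
    exact differentiableAt_zeta_add (by simpa [hm] using hw)
  · have h : ∀ᶠ w in 𝓝 (0 : ℂ), w + m ≠ 1 :=
      (continuous_id.add continuous_const).continuousAt.eventually_ne (by simpa using hm)
    exact (h.filter_mono nhdsWithin_le_nhds).mono fun w hw => differentiableAt_zeta_add hw

theorem tendsto_mul_zeta_add (m : ℂ) :
    Tendsto (fun w => w * riemannZeta (w + m)) (𝓝[≠] 0) (𝓝 (if m = 1 then 1 else 0)) := by
  split_ifs with hm
  · subst hm
    have h : Tendsto (fun w : ℂ => w + 1) (𝓝[≠] 0) (𝓝[≠] 1) := by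
      refine tendsto_nhdsWithin_of_tendsto_nhds_of_eventually_within _ ?_ ?_
      · exact ((continuous_id.add continuous_const).tendsto' 0 1 (zero_add 1)).mono_left
          nhdsWithin_le_nhds
      · filter_upwards [self_mem_nhdsWithin] with w hw
        simpa using hw
    refine (riemannZeta_residue_one.comp h).congr fun w => ?_
    simp
  · have h : ContinuousAt (fun w => w * riemannZeta (w + m)) 0 :=
      continuousAt_id.mul (differentiableAt_zeta_add (by simpa using hm)).continuousAt
    simpa using h.tendsto.mono_left (nhdsWithin_le_nhds (s := {0}ᶜ))

theorem meromorphic_riemannZeta : Meromorphic riemannZeta := by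
  intro s
  by_cases hs : s = 1
  · subst hs
    -- The exponent 2 makes the product continuous at 1 whatever value `riemannZeta` has there. With
    -- exponent 1 the product would be 0 at the point but tend to 1.
    refine ⟨2, Complex.analyticAt_of_differentiable_on_punctured_nhds_of_continuousAt ?_ ?_⟩
    · filter_upwards [self_mem_nhdsWithin] with w hw
      exact ((differentiableAt_id.sub_const 1).pow 2).smul (differentiableAt_riemannZeta hw)
    · rw [continuousAt_iff_punctured_nhds]
      have h : Tendsto (fun w : ℂ => w - 1) (𝓝[≠] 1) (𝓝 0) :=
        ((continuous_id.sub continuous_const).tendsto' 1 0 (sub_self 1)).mono_left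
          nhdsWithin_le_nhds
      have h1 := h.mul riemannZeta_residue_one
      simp only [sub_self, smul_eq_mul]
      rw [zero_pow two_ne_zero, zero_mul]
      refine (h1.congr fun w => ?_).mono_right (by simp)
      ring
  · refine AnalyticAt.meromorphicAt
      (Complex.analyticAt_of_differentiable_on_punctured_nhds_of_continuousAt ?_
        (differentiableAt_riemannZeta hs).continuousAt)
    filter_upwards [nhdsWithin_le_nhds (isOpen_ne.mem_nhds hs)] with w hw
    exact differentiableAt_riemannZeta hw

theorem meromorphic_zeta_add (m : ℂ) : Meromorphic fun w => riemannZeta (w + m) := fun s =>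
  (meromorphic_riemannZeta (s + m)).comp_analyticAt (g := fun w => w + m) (by fun_prop)

theorem absDiracPow_mul (s t : ℂ) (hs : 0 ≤ s.re) (ht : 0 ≤ t.re) (hst : 0 ≤ (s + t).re) :
    absDiracPow s hs * absDiracPow t ht = absDiracPow (s + t) hst := by
  ext ψ x
  rw [mul_apply_eq_comp, absDiracPow_apply, absDiracPow_apply, absDiracPow_apply, ← mul_assoc,
    ← Complex.cpow_add _ _ (Complex.ofReal_ne_zero.mpr
      (zero_lt_one.trans_le (one_le_abs_diracEigenvalue x)).ne'), neg_add]

/-- Multiplying by `|D|^{-n}` translates the zeta function by `n`, and `ζ(s + m)` has a pole at `s =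
0` only for `m = 1`. Thus `n = 3, 2, 1` isolate `A`, `B`, `C`. -/
theorem hasNCIntegral_of_zeta {T : BH} {A B C : ℂ} {h : ℂ → ℂ} (hh : Differentiable ℂ h)
    (hT : ∀ s : ℂ, 3 < s.re → ∀ hs' : 0 ≤ s.re, HasTrace (T * absDiracPow s hs')
        (A * riemannZeta (s - 2) + B * riemannZeta (s - 1) + C * riemannZeta s + h s))
    (n : ℂ) (hn : 0 ≤ n.re) :
    HasNCIntegral (T * absDiracPow n hn) (A * (if n - 2 = 1 then 1 else 0) +
      B * (if n - 1 = 1 then 1 else 0) + C * (if n = 1 then 1 else 0)) := by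
  have hh' : Differentiable ℂ fun s => h (s + n) := hh.comp (differentiable_id.add_const n)
  refine ⟨fun s => A * riemannZeta (s + (n - 2)) + B * riemannZeta (s + (n - 1)) +
    C * riemannZeta (s + n) + h (s + n), fun s => ?_, ⟨3, fun s hs hs3 => ?_⟩,
    hasResidueAt_zero ?_ ?_⟩
  · exact (((MeromorphicAt.const A s).mul (meromorphic_zeta_add _ s)).add
      ((MeromorphicAt.const B s).mul (meromorphic_zeta_add _ s))).add
      ((MeromorphicAt.const C s).mul (meromorphic_zeta_add _ s)) |>.add
      (hh'.analyticAt s).meromorphicAt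
  · have h3 : 3 < (n + s).re := by rw [Complex.add_re]; linarith
    have h := hT (n + s) h3 (by linarith)
    rw [mul_assoc, absDiracPow_mul n s hn hs (by linarith)]
    convert! h using 1
    ring_nf
  · filter_upwards [eventually_differentiableAt_zeta_add (n - 2),
      eventually_differentiableAt_zeta_add (n - 1), eventually_differentiableAt_zeta_add n]
      with w h2 h1 h0
    exact (((h2.const_mul A).add (h1.const_mul B)).add (h0.const_mul C)).add (hh' w)
  · have h4 : Tendsto (fun w => w * h (w + n)) (𝓝[≠] 0) (𝓝 0) := by
      have : ContinuousAt (fun w => w * h (w + n)) 0 :=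
        (continuous_id.mul hh'.continuous).continuousAt
      simpa using this.tendsto.mono_left (nhdsWithin_le_nhds (s := {0}ᶜ))
    have h5 := ((((tendsto_mul_zeta_add (n - 2)).const_mul A).add
      ((tendsto_mul_zeta_add (n - 1)).const_mul B)).add
      ((tendsto_mul_zeta_add n).const_mul C)).add h4
    rw [add_zero] at h5
    refine h5.congr fun w => ?_
    ring

end SUq2

end

theorem mainTheorem4 (q : Set.Ioo (0 : ℝ) 1) :
    ∃ τ₀p τ₀m : SUq2.PairAlg →ₗ[ℂ] ℂ,
      SUq2.IsTau0Plus q τ₀p ∧ SUq2.IsTau0Minus q τ₀m ∧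
      ∀ T ∈ SUq2.XXHat q,
        (∃ P : SUq2.FreeStar SUq2.XGen ⊗[ℂ] SUq2.FreeStar SUq2.XGen,
          SUq2.realize q P = T) ∧
        ∀ P, SUq2.realize q P = T →
          -- the zeta function modulo entire functions
          (∃ h : ℂ → ℂ, Differentiable ℂ h ∧
            ∀ (s : ℂ) (hs : 3 < s.re),
              SUq2.HasTrace (T * SUq2.absDiracPow s (by linarith))
                (2 * SUq2.tensorFun SUq2.tau1 SUq2.tau1 (SUq2.rhoTilde q P) * riemannZeta (s - 2)
                  + 2 * (SUq2.tensorFun τ₀p SUq2.tau1 + SUq2.tensorFun SUq2.tau1 τ₀m)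
                      (SUq2.rhoTilde q P) * riemannZeta (s - 1)
                  + 2 * (SUq2.tensorFun τ₀p τ₀m
                        - (1 / 4 : ℂ) • SUq2.tensorFun SUq2.tau1 SUq2.tau1)
                      (SUq2.rhoTilde q P) * riemannZeta s
                  + h s)) ∧
          -- the noncommutative integrals
          SUq2.HasNCIntegral (T * SUq2.absDiracPow 3 (by norm_num))
            (2 * SUq2.tensorFun SUq2.tau1 SUq2.tau1 (SUq2.rhoTilde q P)) ∧
          SUq2.HasNCIntegral (T * SUq2.absDiracPow 2 (by norm_num))
            (2 * (SUq2.tensorFun τ₀p SUq2.tau1 + SUq2.tensorFun SUq2.tau1 τ₀m)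
              (SUq2.rhoTilde q P)) ∧
          SUq2.HasNCIntegral (T * SUq2.absDiracPow 1 (by norm_num))
            (2 * (SUq2.tensorFun τ₀p τ₀m - (1 / 4 : ℂ) • SUq2.tensorFun SUq2.tau1 SUq2.tau1)
              (SUq2.rhoTilde q P)) := by
  obtain ⟨τ₀p, hp⟩ := SUq2.exists_tau0Plus q
  obtain ⟨τ₀m, hm⟩ := SUq2.exists_tau0Minus q
  refine ⟨τ₀p, τ₀m, hp, hm, fun T hT => ⟨?_, fun P hP => ?_⟩⟩
  · rwa [← SUq2.range_realize] at hT
  · obtain ⟨h, hh, hz⟩ := SUq2.exists_hasTrace_zeta (SUq2.levelTrace_asymptotics hp hm P)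
    rw [hP] at hz
    refine ⟨⟨h, hh, fun s hs => hz s hs _⟩, ?_, ?_, ?_⟩
    · have h3 := SUq2.hasNCIntegral_of_zeta hh hz 3 (by norm_num)
      -- Deciding the three conditions leaves a single coefficient.
      norm_num at h3
      exact h3
    · have h2 := SUq2.hasNCIntegral_of_zeta hh hz 2 (by norm_num)
      norm_num at h2
      exact h2
    · have h1 := SUq2.hasNCIntegral_of_zeta hh hz 1 (by norm_num)
      norm_num at h1
      exact h1
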